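/- **Setting.** All alphabets are finite and all Hilbert spaces are finite-dimensional. In one round, inputs $x\in\mathcal X$, $y\in\mathcal Y$ and a test bit $t\in\{0,1\}$ are drawn from a distribution $\mathrm P(X=x,Y=y,T=t)$ such that, given $T=0$, the inputs lie in $\mathcal X_K\times\mathcal Y_K$ (key inputs) and, given $T=1$, in $\mathcal X_T\times\mathcal Y_T$ (test inputs). For every $x$, $\{M_{a|x}\}_{a\in\mathcal A_x}$ is a POVM on $Q_A$; for every $y$, $\{N_{b|y}\}_{b\in\mathcal B_y}$ is a POVM on $Q_B$. The test data are $\bar c=f(a,b,x,y,t)$, with $\bar c=\perp$ if and only if $t=0$. For a normalized state $\sigma_{Q_AQ_BE}$ the round outputs $$\mathcal M(\sigma)_{A\bar CXYTE}=\sum_{x,y,t}\mathrm P(X=x,Y=y,T=t)\sum_{a,b}|a,\bar c\rangle\langle a,\bar c|\otimes\operatorname{Tr}_{Q_AQ_B}\big[(M_{a|x}\otimes N_{b|y}\otimes\mathbb 1_E)\,\sigma_{Q_AQ_BE}\big]\otimes|x,y,t\rangle\langle x,y,t|.$$ Write $\mathcal M(\sigma)_{AE|X=x}=\sum_{a\in\mathcal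 A_x}|a\rangle\langle a|\otimes\operatorname{Tr}_{Q_AQ_B}[(M_{a|x}\otimes\mathbb 1_{Q_B}\otimes\mathbb 1_E)\sigma_{Q_AQ_BE}]$, and let $\mathcal M(\sigma)_E$ be the marginal of $\mathcal M(\sigma)$ on $E$. For $\rho,\tau\ge 0$ with $\operatorname{Tr}\rho>0$ and $\alpha\in(1,2)$, the Petz–Rényi divergence is $D_\alpha(\rho\|\tau)=\frac1{\alpha-1}\log_2\frac{\operatorname{Tr}[\rho^\alpha\tau^{1-\alpha}]}{\operatorname{Tr}\rho}$ if $\ker\tau\subseteq\ker\rho$ and $+\infty$ otherwise (negative powers are taken on the support), and $H_\alpha(A|B)_\rho=-D_\alpha(\rho_{AB}\|\mathbb 1_A\otimes\rho_B)$. If $\mathrm P(T=0)>0$, $H_\alpha(A|T=0,XE)_{\mathcal M(\sigma)}$ is $H_\alpha(A|XE)$ of the marginal on $AXE$ of $\mathcal M(\sigma)$ conditioned on $T=0$. **Proposition.** Let $\alpha\in(1,2)$. (i) For every such round with $\mathrm P(T=0)>0$ and every normalized state $\sigma_{Q_AQ_BE}$, $$H_\alpha(A|T=0,XE)_{\mathcal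 M(\sigma)}=\frac1{1-\alpha}\log_2\Big(\sum_{x\in\mathcal X_K}\mathrm P(X=x|T=0)\,\operatorname{Tr}\big[\mathcal M(\sigma)_{AE|X=x}^{\alpha}\cdot\mathbb 1_A\otimes\mathcal M(\sigma)_E^{1-\alpha}\big]\Big).$$ (ii) For every integer $m\ge1$ there exist $t_1,\dots,t_m\in(0,1]$ and $w_1,\dots,w_m>0$, depending only on $\alpha$ and $m$, such that for every such round, every normalized state $\sigma_{Q_AQ_BE}$ and every $x\in\mathcal X_K$, $$\operatorname{Tr}\big[\mathcal M(\sigma)_{AE|X=x}^{\alpha}\cdot\mathbb 1_A\otimes\mathcal M(\sigma)_E^{1-\alpha}\big]\le\sup_{(Z_{a,i}^x)}\sum_{a\in\mathcal A_x}\operatorname{Tr}\Big[\sigma_{Q_AQ_BE}\Big(M_{a|x}\otimes\mathbb 1_{Q_B}\otimes P(Z_{a,1}^x,\dots,Z_{a,m}^x)+\mathbb 1_{Q_AQ_B}\otimes Q(Z_{a,1}^x,\dots,Z_{a,m}^x)\Big)\Big],$$ where the supremum, which is finite, is over all families of linear operators $Z_{a,i}^x$ on the Hilbert space of $E$, and $$P(Z_1,\dots,Z_m)=\mathbb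 1+\frac{\sin(\alpha\pi)}{\pi}\sum_{i=1}^m\frac{w_i}{t_i}\big(\mathbb 1+Z_i+Z_i^\dagger+(1-t_i)Z_i^\dagger Z_i\big),\qquad Q(Z_1,\dots,Z_m)=\frac{\sin(\alpha\pi)}{\pi}\sum_{i=1}^m w_i\,Z_iZ_i^\dagger.$$ -/

import Mathlib

open scoped Kronecker Matrix ComplexOrder

namespace DIRenyi

section Linear

variable {m n : Type*} [Fintype m] [Fintype n]

/-- Partial trace over the first tensor factor. -/
def traceLeft (R : Matrix (m × n) (m × n) ℂ) : Matrix n n ℂ :=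
  fun i j => ∑ k, R (k, i) (k, j)

/-- The projector `|k⟩⟨k|` onto a computational basis vector of a classical register. -/
def ketbra [DecidableEq m] (k : m) : Matrix m m ℂ := Matrix.single k k 1

/-- Normalized states. -/
def IsState (ρ : Matrix n n ℂ) : Prop := ρ.PosSemidef ∧ ρ.trace = 1

/-- The real power `ρ ^ s` of a positive semidefinite matrix, by the functional calculus.
Since `(0 : ℝ) ^ s = 0` for `s ≠ 0`, negative powers are taken on the support
(generalized inverse). -/
noncomputable def mpow [DecidableEq n] (ρ : Matrix n n ℂ) (s : ℝ) : Matrix n n ℂ :=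
  cfc (fun r : ℝ => r ^ s) ρ

/-- The quantity `Tr[ρ ^ α * σ ^ (1 - α)]` (a real number for positive semidefinite
`ρ` and `σ`). -/
noncomputable def petzTrace [DecidableEq n] (α : ℝ) (ρ σ : Matrix n n ℂ) : ℝ :=
  (mpow ρ α * mpow σ (1 - α)).trace.re

/-- `ρ ≪ σ`: the kernel of `σ` is contained in the kernel of `ρ`. -/
def Dominated (ρ σ : Matrix n n ℂ) : Prop := ∀ v : n → ℂ, σ *ᵥ v = 0 → ρ *ᵥ v = 0

/-- `ρ ⊥ σ`: orthogonality of operators. -/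
def Orthogonal (ρ σ : Matrix n n ℂ) : Prop := ρ * σ = 0 ∧ σ * ρ = 0

open Classical in
/-- The Petz–Rényi divergence (base `2`), with values in the extended reals. -/
noncomputable def petzDivergence [DecidableEq n] (α : ℝ) (ρ σ : Matrix n n ℂ) : EReal :=
  if (α < 1 ∧ ¬ Orthogonal ρ σ) ∨ Dominated ρ σ then
    ((1 / (α - 1) * Real.logb 2 (petzTrace α ρ σ / ρ.trace.re) : ℝ) : EReal)
  else ⊤

/-- The Petz–Rényi conditional entropy `H_α(A|B) = - D_α(ρ_AB ‖ 1_A ⊗ ρ_B)`. -/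
noncomputable def petzCondEntropy [DecidableEq m] [DecidableEq n] (α : ℝ)
    (ρ : Matrix (m × n) (m × n) ℂ) : EReal :=
  - petzDivergence α ρ ((1 : Matrix m m ℂ) ⊗ₖ traceLeft ρ)

/-- The partial state `ρ_{Q ∧ c}` of a state that is classical on its first register. -/
def partialState (ρ : Matrix (m × n) (m × n) ℂ) (c : m) : Matrix n n ℂ :=
  fun i j => ρ (c, i) (c, j)

/-- The conditional state `ρ_{Q | c}` of a state that is classical on its first register. -/
noncomputable def conditionalState (ρ : Matrix (m × n) (m × n) ℂ) (c : m) : Matrix n n ℂ :=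
  (ρ.trace / (partialState ρ c).trace) • partialState ρ c

end Linear

/-- The classical description of one round: key and test inputs, the output alphabets
`outA x`, `outB y` (inside common finite alphabets), the test function, and the joint
distribution `P x y t` of the inputs and of the test bit (`t = 0`: key generation round,
`t = 1`: test round). -/
structure Protocol (𝒳 𝒴 𝒜 ℬ 𝒞 : Type*) [Fintype 𝒳] [Fintype 𝒴] where
  keyX : Finset 𝒳
  keyY : Finset 𝒴
  testX : Finset 𝒳
  testY : Finset 𝒴
  outA : 𝒳 → Finset 𝒜
  outB : 𝒴 → Finset ℬ
  test : 𝒜 → ℬ → 𝒳 → 𝒴 → 𝒞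
  P : 𝒳 → 𝒴 → Fin 2 → ℝ
  P_nonneg : ∀ x y t, 0 ≤ P x y t
  P_sum : ∑ x, ∑ y, ∑ t, P x y t = 1
  P_key : ∀ x y, P x y 0 ≠ 0 → x ∈ keyX ∧ y ∈ keyY
  P_test : ∀ x y, P x y 1 ≠ 0 → x ∈ testX ∧ y ∈ testY

namespace Protocol

variable {𝒳 𝒴 𝒜 ℬ 𝒞 : Type*} [Fintype 𝒳] [Fintype 𝒴] (p : Protocol 𝒳 𝒴 𝒜 ℬ 𝒞)

/-- The probability that the round is a key generation round, `P(T = 0)`. -/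
def probKey : ℝ := ∑ x, ∑ y, p.P x y 0

/-- The conditional probability `P(X = x | T = 0)`. -/
noncomputable def probXKey (x : 𝒳) : ℝ := (∑ y, p.P x y 0) / p.probKey

/-- The test data: `⊥` (that is `none`) in key generation rounds, and the value of the test
function in test rounds. -/
def testData (a : 𝒜) (b : ℬ) (x : 𝒳) (y : 𝒴) (t : Fin 2) : Option 𝒞 :=
  if t = 0 then none else some (p.test a b x y)

end Protocol

/-- The measurement devices: for every input of Alice and of Bob a POVM on her, respectively
his, quantum system. -/
structure Devices {𝒳 𝒴 𝒜 ℬ 𝒞 : Type*} [Fintype 𝒳] [Fintype 𝒴] (p : Protocol 𝒳 𝒴 𝒜 ℬ 𝒞)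
    (qA qB : Type*) [Fintype qA] [Fintype qB] [DecidableEq qA] [DecidableEq qB] where
  M : 𝒳 → 𝒜 → Matrix qA qA ℂ
  N : 𝒴 → ℬ → Matrix qB qB ℂ
  M_pos : ∀ x, ∀ a ∈ p.outA x, (M x a).PosSemidef
  M_sum : ∀ x, ∑ a ∈ p.outA x, M x a = 1
  N_pos : ∀ y, ∀ b ∈ p.outB y, (N y b).PosSemidef
  N_sum : ∀ y, ∑ b ∈ p.outB y, N y b = 1

namespace Devices

variable {𝒳 𝒴 𝒜 ℬ 𝒞 : Type*} [Fintype 𝒳] [Fintype 𝒴] [Fintype 𝒜] [Fintype ℬ] [Fintype 𝒞]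
  [DecidableEq 𝒳] [DecidableEq 𝒴] [DecidableEq 𝒜] [DecidableEq 𝒞]
  {p : Protocol 𝒳 𝒴 𝒜 ℬ 𝒞}
  {qA qB e : Type*} [Fintype qA] [Fintype qB] [Fintype e]
  [DecidableEq qA] [DecidableEq qB] [DecidableEq e]
  (d : Devices p qA qB) (σ : Matrix (qA × qB × e) (qA × qB × e) ℂ)

/-- The output of the round for fixed `x, y, t`, on the registers `C̄ A E`:
`∑_{a,b} |c̄⟩⟨c̄| ⊗ |a⟩⟨a| ⊗ Tr_{Q_A Q_B}[(M_{a|x} ⊗ N_{b|y} ⊗ 1_E) σ]`. -/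
def roundOutput (x : 𝒳) (y : 𝒴) (t : Fin 2) :
    Matrix (Option 𝒞 × 𝒜 × e) (Option 𝒞 × 𝒜 × e) ℂ :=
  ∑ a ∈ p.outA x, ∑ b ∈ p.outB y,
    ketbra (p.testData a b x y t) ⊗ₖ (ketbra a ⊗ₖ
      traceLeft (traceLeft ((d.M x a ⊗ₖ (d.N y b ⊗ₖ (1 : Matrix e e ℂ))) * σ)))

/-- The output `ℳ(σ)` of the round, with the registers in the order `T Y C̄ A X E`:
`∑_{x,y,t} P(x,y,t) ℳ(σ)_{A C̄ E | x,y,t} ⊗ |x,y,t⟩⟨x,y,t|`. -/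
def output : Matrix (Fin 2 × 𝒴 × Option 𝒞 × 𝒜 × 𝒳 × e) (Fin 2 × 𝒴 × Option 𝒞 × 𝒜 × 𝒳 × e) ℂ :=
  fun i j => ∑ x, ∑ y, ∑ t, (p.P x y t : ℂ) *
    (ketbra t i.1 j.1 * ketbra y i.2.1 j.2.1 * ketbra x i.2.2.2.2.1 j.2.2.2.2.1 *
      d.roundOutput σ x y t (i.2.2.1, i.2.2.2.1, i.2.2.2.2.2) (j.2.2.1, j.2.2.2.1, j.2.2.2.2.2))

/-- The state `ℳ(σ)_{A X E | T = 0}`: condition on `T = 0`, then discard `Y` and `C̄`. -/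
noncomputable def keyState : Matrix (𝒜 × 𝒳 × e) (𝒜 × 𝒳 × e) ℂ :=
  traceLeft (traceLeft (conditionalState (d.output σ) 0))

/-- The entropy `H_α(A | T = 0, X E)` of `ℳ(σ)`. -/
noncomputable def keyEntropy (α : ℝ) : EReal := petzCondEntropy α (d.keyState σ)

/-- Eve's marginal `ℳ(σ)_E`. -/
def stateE : Matrix e e ℂ :=
  traceLeft (traceLeft (traceLeft (traceLeft (traceLeft (d.output σ)))))

/-- The state `ℳ(σ)_{A E | X = x} = ∑_a |a⟩⟨a| ⊗ Tr_{Q_A Q_B}[(M_{a|x} ⊗ 1 ⊗ 1) σ]`. -/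
def stateAE (x : 𝒳) : Matrix (𝒜 × e) (𝒜 × e) ℂ :=
  ∑ a ∈ p.outA x, ketbra a ⊗ₖ
    traceLeft (traceLeft ((d.M x a ⊗ₖ ((1 : Matrix qB qB ℂ) ⊗ₖ (1 : Matrix e e ℂ))) * σ))

/-- The trace `Tr[ℳ(σ)_{AE|X=x} ^ α · (1_A ⊗ ℳ(σ)_E ^ (1 - α))]`. -/
noncomputable def keyTrace (α : ℝ) (x : 𝒳) : ℝ :=
  (mpow (d.stateAE σ x) α * ((1 : Matrix 𝒜 𝒜 ℂ) ⊗ₖ mpow (d.stateE σ) (1 - α))).trace.re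

end Devices

section Polynomials

variable {e : Type*} [Fintype e] [DecidableEq e] {m : ℕ}

/-- `P(Z₁, …, Z_m) = 1 + (sin (απ) / π) ∑ᵢ (wᵢ / tᵢ) (1 + Zᵢ + Zᵢ† + (1 - tᵢ) Zᵢ† Zᵢ)`. -/
noncomputable def polyP (α : ℝ) (t w : Fin m → ℝ) (Z : Fin m → Matrix e e ℂ) : Matrix e e ℂ :=
  1 + (Real.sin (α * Real.pi) / Real.pi) •
    ∑ i, (w i / t i) • (1 + Z i + (Z i)ᴴ + (1 - t i) • ((Z i)ᴴ * Z i))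

/-- `Q(Z₁, …, Z_m) = (sin (απ) / π) ∑ᵢ wᵢ Zᵢ Zᵢ†`. -/
noncomputable def polyQ (α : ℝ) (w : Fin m → ℝ) (Z : Fin m → Matrix e e ℂ) : Matrix e e ℂ :=
  (Real.sin (α * Real.pi) / Real.pi) • ∑ i, w i • (Z i * (Z i)ᴴ)

end Polynomials

/-- The objective function
`∑_a Tr[σ (M_{a|x} ⊗ 1_{Q_B} ⊗ P(Z_{a,1}, …, Z_{a,m}) + 1_{Q_A Q_B} ⊗ Q(Z_{a,1}, …, Z_{a,m}))]`,
where every `Z a i` is an operator on Eve's system. -/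
noncomputable def Devices.objective {𝒳 𝒴 𝒜 ℬ 𝒞 : Type*} [Fintype 𝒳] [Fintype 𝒴]
    {p : Protocol 𝒳 𝒴 𝒜 ℬ 𝒞}
    {qA qB e : Type*} [Fintype qA] [Fintype qB] [Fintype e]
    [DecidableEq qA] [DecidableEq qB] [DecidableEq e]
    (d : Devices p qA qB) (σ : Matrix (qA × qB × e) (qA × qB × e) ℂ)
    (α : ℝ) {m : ℕ} (t w : Fin m → ℝ) (x : 𝒳) (Z : 𝒜 → Fin m → Matrix e e ℂ) : ℝ :=
  ∑ a ∈ p.outA x,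
    (σ * (d.M x a ⊗ₖ ((1 : Matrix qB qB ℂ) ⊗ₖ polyP α t w (Z a)) +
      (1 : Matrix qA qA ℂ) ⊗ₖ ((1 : Matrix qB qB ℂ) ⊗ₖ polyQ α w (Z a)))).trace.re

end DIRenyi

open DIRenyi

/-!
The power `x ^ (α - 1)` is an integral of the kernels `(x - 1) / (t + (1 - t) x)` against a beta
distribution in `t ∈ (0, 1)`. The substitution `z = x / (x - 1)` turns them into Cauchy kernels
`(z - t)⁻¹`, and a Gauss–Radau rule with `m` nodes, one of them fixed at `t = 1`, overestimates
their integral: the rule is exact on the polynomial that interpolates the kernel doubly at the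
interior nodes and simply at `1`, and this polynomial lies above the kernel on `(0, 1)`. Hence
`x ^ (α - 1)` is bounded by a sum of `m` rational terms with positive weights.

The trace `Tr[ρ ^ α τ ^ (1 - α)]` is a sum over pairs of eigenvalues `l` of `ρ` and `u` of `τ`,
weighted by the squared overlaps of the eigenvectors. In such a pair, each rational term at
`x = l / u` is, up to sign, the minimum of a quadratic in a scalar `z`; the minimizers for all the
pairs are the entries of a single operator `Z`, written in the eigenbases of `ρ` and `τ`, and the
weighted sum of the quadratics is the trace functional of `Z` in the objective. The entropy formula
holds because the states are block diagonal in the classical registers `A` and `X`, so that the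
functional calculus acts blockwise.
-/

namespace DIRenyi

section Quadrature

open Polynomial Set

/-- Strict positivity of a linear functional on polynomials over the interval `(a, b)`, the
property of integration against a measure under which orthogonal polynomials and Gaussian
quadrature exist. -/
def StrictlyPositiveOn (Λ : ℝ[X] →ₗ[ℝ] ℝ) (a b : ℝ) : Prop :=
  ∀ p : ℝ[X], p ≠ 0 → (∀ t ∈ Ioo a b, 0 ≤ p.eval t) → 0 < Λ p

/-- Monic orthogonal polynomials of a linear functional, the orthogonality being with respect to
the bilinear form `(q, r) ↦ Λ (q * r)`. -/
structure IsOrthogonalPolynomial (Λ : ℝ[X] →ₗ[ℝ] ℝ) (q : ℝ[X]) : Prop where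
  monic : q.Monic
  apply_mul_eq_zero : ∀ r : ℝ[X], r.degree < q.degree → Λ (q * r) = 0

variable {Λ : ℝ[X] →ₗ[ℝ] ℝ} {a b : ℝ}

lemma StrictlyPositiveOn.comp_mulLeft (hΛ : StrictlyPositiveOn Λ a b) {d : ℝ[X]} (hd₀ : d ≠ 0)
    (hd : ∀ t ∈ Ioo a b, 0 ≤ d.eval t) :
    StrictlyPositiveOn (Λ ∘ₗ LinearMap.mulLeft ℝ d) a b := fun p hp₀ hp =>
  hΛ _ (mul_ne_zero hd₀ hp₀) fun t ht => by
    simpa only [LinearMap.mulLeft_apply, eval_mul] using mul_nonneg (hd t ht) (hp t ht)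

lemma exists_mem_forall_bilin_eq {K V : Type*} [Field K] [AddCommGroup V] [Module K V]
    (B : V →ₗ[K] V →ₗ[K] K) (W : Submodule K V) [FiniteDimensional K W]
    (hB : ∀ w ∈ W, B w w = 0 → w = 0) (φ : Module.Dual K V) :
    ∃ w ∈ W, ∀ v ∈ W, B w v = φ v := by
  let F : W →ₗ[K] Module.Dual K W := W.subtype.dualMap ∘ₗ B ∘ₗ W.subtype
  have hF : Function.Injective F := (injective_iff_map_eq_zero F).2 fun w hw =>
    Subtype.ext (hB w w.2 (DFunLike.congr_fun hw w))
  obtain ⟨w, hw⟩ := (LinearMap.injective_iff_surjective_of_finrank_eq_finrank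
    Subspace.dual_finrank_eq.symm).1 hF (W.subtype.dualMap φ)
  exact ⟨w, w.2, fun v hv => DFunLike.congr_fun hw ⟨v, hv⟩⟩

lemma StrictlyPositiveOn.exists_isOrthogonalPolynomial (hΛ : StrictlyPositiveOn Λ a b) (n : ℕ) :
    ∃ q, IsOrthogonalPolynomial Λ q ∧ q.natDegree = n := by
  let B : ℝ[X] →ₗ[ℝ] ℝ[X] →ₗ[ℝ] ℝ := (LinearMap.mul ℝ ℝ[X]).compr₂ Λ
  have hB : ∀ p, B p p = 0 → p = 0 := fun p hp => by
    by_contra hp₀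
    refine (hΛ (p * p) (mul_self_ne_zero.2 hp₀) fun t _ => ?_).ne' hp
    simpa only [eval_mul] using mul_self_nonneg _
  have : FiniteDimensional ℝ (degreeLT ℝ n) := (degreeLTEquiv ℝ n).symm.finiteDimensional
  obtain ⟨r, hr, hBr⟩ :=
    exists_mem_forall_bilin_eq B (degreeLT ℝ n) (fun p _ => hB p) (B (X ^ n))
  rw [mem_degreeLT] at hr
  have hdeg : (X ^ n - r).degree = (n : WithBot ℕ) := by
    rw [degree_sub_eq_left_of_degree_lt (by simpa using hr), degree_X_pow]
  refine ⟨X ^ n - r, ⟨monic_X_pow_sub (by simpa using hr), fun s hs => ?_⟩,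
    natDegree_eq_of_degree_eq_some hdeg⟩
  have hrs : Λ (r * s) = Λ (X ^ n * s) := hBr s (mem_degreeLT.2 (hs.trans_eq hdeg))
  rw [sub_mul, map_sub, hrs, sub_self]

lemma IsOrthogonalPolynomial.natDegree_eq_zero_of_dvd {q d : ℝ[X]}
    (hq : IsOrthogonalPolynomial Λ q) (hΛ : StrictlyPositiveOn Λ a b) (hdq : d ∣ q)
    (hd : (∀ t ∈ Ioo a b, 0 ≤ d.eval t) ∨ ∀ t ∈ Ioo a b, d.eval t ≤ 0) : d.natDegree = 0 := by
  wlog hd' : ∀ t ∈ Ioo a b, 0 ≤ d.eval t generalizing d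
  · rw [← natDegree_neg]
    have hneg : ∀ t ∈ Ioo a b, 0 ≤ (-d).eval t := by
      simpa only [eval_neg, neg_nonneg] using hd.resolve_left hd'
    exact this (neg_dvd.2 hdq) (Or.inl hneg) hneg
  by_contra hdeg
  obtain ⟨h, rfl⟩ := hdq
  obtain ⟨hd₀, hh₀⟩ := mul_ne_zero_iff.1 hq.monic.ne_zero
  have hlt : h.degree < (d * h).degree := by
    rw [degree_mul, degree_eq_natDegree hd₀, degree_eq_natDegree hh₀]
    exact_mod_cast Nat.lt_add_of_pos_left (Nat.pos_of_ne_zero hdeg)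
  refine (hΛ (d * h * h) (mul_ne_zero hq.monic.ne_zero hh₀) fun t ht => ?_).ne'
    (hq.apply_mul_eq_zero h hlt)
  simpa only [eval_mul, mul_assoc] using mul_nonneg (hd' t ht) (mul_self_nonneg (h.eval t))

lemma eval_nonneg_or_eval_nonpos_of_roots_eq_zero {h : ℝ[X]} (hh : h ≠ 0) (hroots : h.roots = 0) :
    (∀ t, 0 ≤ h.eval t) ∨ ∀ t, h.eval t ≤ 0 := by
  by_contra! hcon
  obtain ⟨⟨x, hx⟩, y, hy⟩ := hcon
  obtain ⟨c, hc⟩ := mem_range_of_exists_le_of_exists_ge h.continuous ⟨x, hx.le⟩ ⟨y, hy.le⟩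
  have hmem : c ∈ h.roots := (mem_roots hh).2 hc
  simp [hroots] at hmem

lemma IsOrthogonalPolynomial.card_roots {q : ℝ[X]} (hq : IsOrthogonalPolynomial Λ q)
    (hΛ : StrictlyPositiveOn Λ a b) : q.roots.card = q.natDegree := by
  obtain ⟨h, hh, hdeg, hroots⟩ := exists_prod_multiset_X_sub_C_mul q
  have hh₀ : h ≠ 0 := right_ne_zero_of_mul (hh.trans_ne hq.monic.ne_zero)
  have hconst : h.natDegree = 0 := hq.natDegree_eq_zero_of_dvd hΛ (Dvd.intro_left _ hh)
    ((eval_nonneg_or_eval_nonpos_of_roots_eq_zero hh₀ hroots).imp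
      (fun hs t _ => hs t) fun hs t _ => hs t)
  rw [← hdeg, hconst, add_zero]

lemma IsOrthogonalPolynomial.nodup_roots {q : ℝ[X]} (hq : IsOrthogonalPolynomial Λ q)
    (hΛ : StrictlyPositiveOn Λ a b) : q.roots.Nodup := by
  refine Multiset.nodup_iff_count_le_one.2 fun c => ?_
  rw [count_roots]
  by_contra! hlt
  have hsq : ((X - C c) ^ 2).natDegree = 0 := hq.natDegree_eq_zero_of_dvd hΛ
    ((le_rootMultiplicity_iff hq.monic.ne_zero).1 hlt)
    (Or.inl fun t _ => by simpa only [eval_pow] using sq_nonneg _)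
  simp at hsq

lemma IsOrthogonalPolynomial.mem_Ioo_of_mem_roots {q : ℝ[X]} (hq : IsOrthogonalPolynomial Λ q)
    (hΛ : StrictlyPositiveOn Λ a b) {c : ℝ} (hc : c ∈ q.roots) : c ∈ Ioo a b := by
  by_contra hmem
  rw [mem_Ioo, not_and_or, not_lt, not_lt] at hmem
  have hlin : (X - C c).natDegree = 0 := hq.natDegree_eq_zero_of_dvd hΛ
    (dvd_iff_isRoot.2 ((mem_roots hq.monic.ne_zero).1 hc)) <|
    hmem.imp (fun hca t ht => by simpa using hca.trans ht.1.le)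
      fun hbc t ht => by simpa using ht.2.le.trans hbc
  simp at hlin

lemma StrictlyPositiveOn.exists_nodal (hΛ : StrictlyPositiveOn Λ a b) (n : ℕ) :
    ∃ s : Finset ℝ, s.card = n ∧ (∀ t ∈ s, t ∈ Ioo a b) ∧
      ∀ r : ℝ[X], r.degree < n → Λ (Lagrange.nodal s id * r) = 0 := by
  obtain ⟨q, hq, hdeg⟩ := hΛ.exists_isOrthogonalPolynomial n
  have hcard := hq.card_roots hΛ
  have hnodal : Lagrange.nodal ⟨q.roots, hq.nodup_roots hΛ⟩ id = q :=
    prod_multiset_X_sub_C_of_monic_of_roots_card_eq hq.monic hcard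
  refine ⟨⟨q.roots, hq.nodup_roots hΛ⟩, hcard.trans hdeg, fun t => hq.mem_Ioo_of_mem_roots hΛ,
    fun r hr => ?_⟩
  rw [hnodal]
  refine hq.apply_mul_eq_zero r ?_
  rwa [degree_eq_natDegree hq.monic.ne_zero, hdeg]

lemma apply_eq_sum_basis_mul_eval {F : Type*} [Field F] [DecidableEq F] {Λ : F[X] →ₗ[F] F}
    {s : Finset F} {n : ℕ} (horth : ∀ r : F[X], r.degree < n → Λ (Lagrange.nodal s id * r) = 0)
    {p : F[X]} (hp : p.degree < (s.card + n : ℕ)) :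
    Λ p = ∑ t ∈ s, Λ (Lagrange.basis s id t) * p.eval t := by
  set ω := Lagrange.nodal s id with hω
  have hmonic : ω.Monic := Lagrange.nodal_monic
  have hrem : (p %ₘ ω).degree < s.card :=
    (degree_modByMonic_lt p hmonic).trans_eq Lagrange.degree_nodal
  have hquot : (p /ₘ ω).degree < n := by
    rcases lt_or_ge p.degree ω.degree with hlt | hge
    · rw [(divByMonic_eq_zero_iff hmonic).2 hlt, degree_zero]
      exact WithBot.bot_lt_coe n
    · rw [← degree_add_divByMonic hmonic hge, Lagrange.degree_nodal, Nat.cast_add] at hp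
      exact lt_of_add_lt_add_left hp
  have heval : ∀ t ∈ s, (p %ₘ ω).eval t = p.eval t := fun t ht => by
    have hroot : ω.eval t = 0 := Lagrange.eval_nodal_at_node (v := id) ht
    rw [modByMonic_eq_sub_mul_div, eval_sub, eval_mul, hroot, zero_mul, sub_zero]
  calc Λ p = Λ (p %ₘ ω) := by
        conv_lhs => rw [← modByMonic_add_div p ω, map_add, horth _ hquot, add_zero]
    _ = Λ (∑ t ∈ s, p.eval t • Lagrange.basis s id t) := by
        rw [Lagrange.eq_interpolate_of_eval_eq (v := id) (fun t => p.eval t)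
          Function.injective_id.injOn hrem heval, Lagrange.interpolate_apply]
        simp only [smul_eq_C_mul]
    _ = ∑ t ∈ s, Λ (Lagrange.basis s id t) * p.eval t := by
        simp only [map_sum, map_smul, smul_eq_mul, mul_comm]

lemma StrictlyPositiveOn.weight_pos (hΛ : StrictlyPositiveOn Λ a b) {s : Finset ℝ} {n : ℕ}
    (hs : s.card = n + 1) {w : ℝ → ℝ}
    (hw : ∀ p : ℝ[X], p.degree < (2 * n + 1 : ℕ) → Λ p = ∑ t ∈ s, w t * p.eval t)
    {t : ℝ} (ht : t ∈ s) : 0 < w t := by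
  have hinj : InjOn id (s : Set ℝ) := Function.injective_id.injOn
  set ℓ := Lagrange.basis s id t with hℓ
  have hself : ℓ.eval t = 1 := Lagrange.eval_basis_self hinj ht
  have hne : ∀ u ∈ s, u ≠ t → ℓ.eval u = 0 := fun u hu hut =>
    Lagrange.eval_basis_of_ne (v := id) hut.symm hu
  have hdeg : (ℓ ^ 2).degree < (2 * n + 1 : ℕ) := by
    rw [degree_pow, hℓ, Lagrange.degree_basis hinj ht, hs, Nat.add_sub_cancel, nsmul_eq_mul]
    exact_mod_cast Nat.lt_succ_self (2 * n)
  calc 0 < Λ (ℓ ^ 2) := hΛ _ (pow_ne_zero 2 (Lagrange.basis_ne_zero hinj ht)) fun u _ => by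
        simpa only [eval_pow] using sq_nonneg _
    _ = ∑ u ∈ s, w u * (ℓ ^ 2).eval u := hw _ hdeg
    _ = w t := by
        rw [Finset.sum_eq_single_of_mem t ht fun u hu hut => by simp [hne u hu hut]]
        simp [hself]

theorem StrictlyPositiveOn.exists_gaussRadau (hΛ : StrictlyPositiveOn Λ a b) (n : ℕ) :
    ∃ (s : Finset ℝ) (w : ℝ → ℝ), s.card = n ∧ (∀ t ∈ s, t ∈ Ioo a b) ∧
      (∀ t ∈ insert b s, 0 < w t) ∧ ∀ p : ℝ[X], p.degree < (2 * n + 1 : ℕ) →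
        Λ p = ∑ t ∈ insert b s, w t * p.eval t := by
  have hb : C b - X ≠ 0 := sub_ne_zero.2 (X_ne_C b).symm
  obtain ⟨s, hcard, hmem, horth⟩ :=
    (hΛ.comp_mulLeft hb fun t ht => by simpa using ht.2.le).exists_nodal n
  have hbs : b ∉ s := fun h => (hmem b h).2.false
  have hcard' : (insert b s).card = n + 1 := by rw [Finset.card_insert_of_notMem hbs, hcard]
  have hexact : ∀ p : ℝ[X], p.degree < (2 * n + 1 : ℕ) →
      Λ p = ∑ t ∈ insert b s, Λ (Lagrange.basis (insert b s) id t) * p.eval t := fun p hp => by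
    refine apply_eq_sum_basis_mul_eval (n := n) (fun r hr => ?_)
      (hp.trans_eq (by rw [hcard']; congr 1; ring))
    rw [Lagrange.nodal_insert_eq_nodal hbs, id, ← neg_sub, neg_mul, neg_mul, map_neg, mul_assoc,
      ← LinearMap.mulLeft_apply (R := ℝ), ← LinearMap.comp_apply, horth r hr, neg_zero]
  refine ⟨s, _, hcard, hmem, fun t ht => ?_, hexact⟩
  exact hΛ.weight_pos hcard' hexact ht

end Quadrature

section Measure

open Polynomial Set MeasureTheory

variable {μ : Measure ℝ} {a b : ℝ}

lemma integrable_of_continuousOn_Icc [IsFiniteMeasure μ] (hμ : ∀ᵐ t ∂μ, t ∈ Ioo a b) {f : ℝ → ℝ}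
    (hf : ContinuousOn f (Icc a b)) : Integrable f μ := by
  have hrestrict : μ.restrict (Icc a b) = μ :=
    Measure.restrict_eq_self_of_ae_mem (hμ.mono fun t ht => Ioo_subset_Icc_self ht)
  simpa only [IntegrableOn, hrestrict] using hf.integrableOn_compact (μ := μ) isCompact_Icc

/-- Integration of polynomials against a finite measure carried by `(a, b)`. -/
noncomputable def integralFunctional [IsFiniteMeasure μ] (hμ : ∀ᵐ t ∂μ, t ∈ Ioo a b) :
    ℝ[X] →ₗ[ℝ] ℝ where
  toFun p := ∫ t, p.eval t ∂μ
  map_add' p q := by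
    simp only [eval_add]
    exact integral_add (integrable_of_continuousOn_Icc hμ p.continuousOn)
      (integrable_of_continuousOn_Icc hμ q.continuousOn)
  map_smul' c p := by
    simp only [eval_smul, smul_eq_mul, integral_const_mul, RingHom.id_apply]

lemma strictlyPositiveOn_integralFunctional [IsFiniteMeasure μ] [NullSingletonClass μ]
    (hμ : ∀ᵐ t ∂μ, t ∈ Ioo a b) (hμ₀ : μ ≠ 0) :
    StrictlyPositiveOn (integralFunctional hμ) a b := fun p hp₀ hp => by
  have hroots : (Function.support fun t => p.eval t)ᶜ ⊆ p.roots.toFinset := fun t ht => by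
    simpa [hp₀] using ht
  have hnull : μ (Function.support fun t => p.eval t)ᶜ = 0 :=
    measure_mono_null hroots (p.roots.toFinset.finite_toSet.measure_zero μ)
  refine (integral_pos_iff_support_of_nonneg_ae (hμ.mono hp)
    (integrable_of_continuousOn_Icc hμ p.continuousOn)).2 (pos_iff_ne_zero.2 fun h₀ => hμ₀ ?_)
  rw [← Measure.measure_univ_eq_zero, ← union_compl_self (Function.support fun t => p.eval t)]
  exact measure_union_null h₀ hnull

lemma exists_sub_mul_eval_eq_one_sub_div {F : Type*} [Field F] {ω : F[X]} {z : F}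
    (hω : ω.eval z ≠ 0) :
    ∃ H : F[X], H.degree < ω.degree ∧
      ∀ t, (z - t) * H.eval t = 1 - ω.eval t / ω.eval z := by
  set p : F[X] := 1 - C (ω.eval z)⁻¹ * ω with hp
  have hω₀ : ω ≠ 0 := by rintro rfl; simp at hω
  have hroot : p.IsRoot z := by simp [hp, hω]
  have hpω : p.degree ≤ ω.degree :=
    (degree_sub_le _ _).trans (max_le (degree_one_le.trans (zero_le_degree_iff.2 hω₀))
      (degree_C_mul (inv_ne_zero hω)).le)
  refine ⟨-(p /ₘ (X - C z)), ?_, fun t => ?_⟩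
  · rw [degree_neg]
    rcases eq_or_ne p 0 with hp₀ | hp₀
    · rw [hp₀, zero_divByMonic, degree_zero]
      exact bot_lt_iff_ne_bot.2 (degree_ne_bot.2 hω₀)
    · exact (degree_divByMonic_lt p _ hp₀ (by simp)).trans_le hpω
  · have hfactor := congrArg (eval t) (mul_divByMonic_eq_iff_isRoot.2 hroot)
    simp only [hp, eval_mul, eval_sub, eval_X, eval_C, eval_one] at hfactor
    rw [eval_neg, mul_neg, ← neg_mul, neg_sub, hfactor, div_eq_inv_mul]

lemma exists_inv_sub_le_eval {s : Finset ℝ} (hs : ∀ t ∈ s, t ∈ Ioo a b) (hab : a < b) {z : ℝ}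
    (hz : z < a ∨ b < z) :
    ∃ H : ℝ[X], H.degree < (2 * s.card + 1 : ℕ) ∧
      (∀ t ∈ insert b s, H.eval t = (z - t)⁻¹) ∧ ∀ t ∈ Ioo a b, (z - t)⁻¹ ≤ H.eval t := by
  set N := Lagrange.nodal s id with hN
  set ω : ℝ[X] := (C b - X) * N ^ 2 with hω
  have hωeval : ∀ t, ω.eval t = (b - t) * N.eval t ^ 2 := fun t => by simp [hω]
  have hωdeg : ω.degree = (2 * s.card + 1 : ℕ) := by
    rw [hω, ← neg_sub, neg_mul, degree_neg, degree_mul, degree_X_sub_C, degree_pow, hN,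
      Lagrange.degree_nodal, nsmul_eq_mul, add_comm]
    norm_cast
  have hne : ∀ t, a < t → t ≤ b → z - t ≠ 0 := fun t hat htb =>
    sub_ne_zero.2 (hz.elim (fun h => (h.trans hat).ne) fun h => (htb.trans_lt h).ne')
  have hNz : N.eval z ≠ 0 := by
    rw [hN, Lagrange.eval_nodal]
    exact Finset.prod_ne_zero_iff.2 fun t ht => hne t (hs t ht).1 (hs t ht).2.le
  have hωz : ω.eval z ≠ 0 := by
    rw [hωeval, ← neg_sub z b]
    exact mul_ne_zero (neg_ne_zero.2 (hne b hab le_rfl)) (pow_ne_zero 2 hNz)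
  obtain ⟨H, hHdeg, hH⟩ := exists_sub_mul_eval_eq_one_sub_div hωz
  refine ⟨H, hHdeg.trans_eq hωdeg, fun t ht => ?_, fun t ht => ?_⟩
  · have hroot : ω.eval t = 0 := by
      rcases Finset.mem_insert.1 ht with rfl | ht
      · simp [hωeval]
      · have hNt : N.eval t = 0 := Lagrange.eval_nodal_at_node (v := id) ht
        rw [hωeval, hNt, zero_pow two_ne_zero, mul_zero]
    exact eq_inv_of_mul_eq_one_right (by rw [hH, hroot, zero_div, sub_zero])
  · have hzt : z - t ≠ 0 := hne t ht.1 ht.2.le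
    have hωt : 0 ≤ ω.eval t := by
      rw [hωeval]
      exact mul_nonneg (sub_nonneg.2 ht.2.le) (sq_nonneg _)
    have hsign : (z - t) * ω.eval z ≤ 0 := by
      rw [hωeval, ← mul_assoc]
      refine mul_nonpos_of_nonpos_of_nonneg ?_ (sq_nonneg _)
      rcases hz with hz | hz <;> nlinarith [ht.1, ht.2]
    calc (z - t)⁻¹ ≤ (z - t)⁻¹ - ω.eval t / ((z - t) * ω.eval z) :=
          le_sub_self_iff _ |>.2 (div_nonpos_of_nonneg_of_nonpos hωt hsign)
      _ = (z - t)⁻¹ * (1 - ω.eval t / ω.eval z) := by field_simp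
      _ = H.eval t := by rw [← hH, inv_mul_cancel_left₀ hzt]

theorem exists_integral_cauchyKernel_le [IsFiniteMeasure μ] [NeZero μ] [NullSingletonClass μ]
    (hμ : ∀ᵐ t ∂μ, t ∈ Ioo a b) (n : ℕ) :
    ∃ (s : Finset ℝ) (w : ℝ → ℝ), s.card = n ∧ (∀ t ∈ s, t ∈ Ioo a b) ∧
      (∀ t ∈ insert b s, 0 < w t) ∧ ∀ z, z < a ∨ b < z →
        ∫ t, (z - t)⁻¹ ∂μ ≤ ∑ t ∈ insert b s, w t * (z - t)⁻¹ := by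
  obtain ⟨s, w, rfl, hs, hw, hexact⟩ :=
    (strictlyPositiveOn_integralFunctional hμ (NeZero.ne μ)).exists_gaussRadau n
  obtain ⟨_, hab⟩ := hμ.exists
  refine ⟨s, w, rfl, hs, hw, fun z hz => ?_⟩
  obtain ⟨H, hHdeg, hHnode, hHle⟩ := exists_inv_sub_le_eval hs (hab.1.trans hab.2) hz
  have hcont : ContinuousOn (fun t => (z - t)⁻¹) (Icc a b) :=
    (continuousOn_const.sub continuousOn_id).inv₀ fun t ht => sub_ne_zero.2
      (hz.elim (fun h => (h.trans_le ht.1).ne) fun h => (ht.2.trans_lt h).ne')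
  calc ∫ t, (z - t)⁻¹ ∂μ ≤ ∫ t, H.eval t ∂μ :=
        integral_mono_ae (integrable_of_continuousOn_Icc hμ hcont)
          (integrable_of_continuousOn_Icc hμ H.continuousOn) (hμ.mono hHle)
    _ = ∑ t ∈ insert b s, w t * H.eval t := hexact H hHdeg
    _ = ∑ t ∈ insert b s, w t * (z - t)⁻¹ :=
        Finset.sum_congr rfl fun t ht => by rw [hHnode t ht]

end Measure

section RationalBound

open MeasureTheory ProbabilityTheory Set

lemma measurable_betaPDF (α β : ℝ) : Measurable (betaPDF α β) :=
  (measurable_betaPDFReal α β).ennreal_ofReal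

lemma ae_mem_Ioo_betaMeasure (α β : ℝ) : ∀ᵐ t ∂betaMeasure α β, t ∈ Ioo 0 1 := by
  refine (ae_withDensity_iff (measurable_betaPDF α β)).2 (.of_forall fun t ht => ?_)
  by_contra hmem
  rcases not_and_or.1 hmem with h | h
  exacts [ht (betaPDF_eq_zero_of_nonpos (not_lt.1 h)), ht (betaPDF_eq_zero_of_one_le (not_lt.1 h))]

instance (α β : ℝ) : NullSingletonClass (betaMeasure α β) :=
  nullSingletonClass_withDensity _

lemma integral_betaMeasure {α β : ℝ} (hα : 0 < α) (hβ : 0 < β) (f : ℝ → ℝ) :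
    ∫ t, f t ∂betaMeasure α β =
      (beta α β)⁻¹ * ∫ t in Ioo 0 1, t ^ (α - 1) * (1 - t) ^ (β - 1) * f t := by
  rw [← Measure.restrict_eq_self_of_ae_mem (ae_mem_Ioo_betaMeasure α β), betaMeasure,
    restrict_withDensity measurableSet_Ioo, integral_withDensity_eq_integral_toReal_smul
      (measurable_betaPDF α β) (.of_forall fun t => ENNReal.ofReal_lt_top),
    ← integral_const_mul]
  refine setIntegral_congr_fun measurableSet_Ioo fun t ht => ?_
  rw [betaPDF, ENNReal.toReal_ofReal (betaPDFReal_pos ht.1 ht.2 hα hβ).le, betaPDFReal,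
    if_pos (mem_Ioo.1 ht), smul_eq_mul, one_div]
  ring

lemma setIntegral_Ioi_zero_eq_setIntegral_Ioo (g : ℝ → ℝ) :
    ∫ u in Ioi 0, g u = ∫ t in Ioo 0 1, ((1 - t) ^ 2)⁻¹ * g (t / (1 - t)) := by
  have hderiv : ∀ t ∈ Ioo (0 : ℝ) 1,
      HasDerivWithinAt (fun t => t / (1 - t)) ((1 - t) ^ 2)⁻¹ (Ioo 0 1) t := fun t ht => by
    have h : HasDerivAt (fun t => t / (1 - t)) ((1 * (1 - t) - t * (0 - 1)) / (1 - t) ^ 2) t :=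
      (hasDerivAt_id t).div ((hasDerivAt_const t 1).sub (hasDerivAt_id t)) (sub_ne_zero.2 ht.2.ne')
    rw [show 1 * (1 - t) - t * (0 - 1) = 1 by ring, one_div] at h
    exact h.hasDerivWithinAt
  have hleft : ∀ t ∈ Ioo (0 : ℝ) 1, t / (1 - t) / (1 + t / (1 - t)) = t := fun t ht => by
    have : 1 - t ≠ 0 := sub_ne_zero.2 ht.2.ne'
    field_simp
    ring
  have himage : (fun t : ℝ => t / (1 - t)) '' Ioo 0 1 = Ioi 0 := by
    refine Subset.antisymm ?_ fun u (hu : 0 < u) => ⟨u / (1 + u), ⟨by positivity, ?_⟩, ?_⟩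
    · rintro _ ⟨t, ht, rfl⟩
      exact div_pos ht.1 (sub_pos.2 ht.2)
    · exact (div_lt_one (by positivity)).2 (by linarith)
    · field_simp
      ring
  rw [← himage, integral_image_eq_integral_abs_deriv_smul measurableSet_Ioo hderiv
    (LeftInvOn.injOn (f₁' := fun u => u / (1 + u)) hleft)]
  simp only [abs_inv, abs_pow, sq_abs, smul_eq_mul]

lemma rpowIntegrand₀₁_sub_rpowIntegrand₀₁_one (r : ℝ) {t x : ℝ} (ht : t ∈ Ioo 0 1) (hx : 0 < x) :
    ((1 - t) ^ 2)⁻¹ * (r.rpowIntegrand₀₁ (t / (1 - t)) x - r.rpowIntegrand₀₁ (t / (1 - t)) 1) =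
      t ^ r * (1 - t) ^ (-r) * ((x - 1) / (t + (1 - t) * x)) := by
  have ht₀ : 0 < t := ht.1
  have ht₁ : 0 < 1 - t := sub_pos.2 ht.2
  have hden : t / (1 - t) + x = (t + (1 - t) * x) / (1 - t) := by field_simp
  have hden₁ : t / (1 - t) + 1 = (1 - t)⁻¹ := by field_simp; ring
  have : 0 < t + (1 - t) * x := by positivity
  rw [Real.rpowIntegrand₀₁, Real.rpowIntegrand₀₁, ← mul_sub, sub_sub_sub_cancel_left, hden, hden₁,
    Real.div_rpow ht₀.le ht₁.le, Real.rpow_neg ht₁.le]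
  field_simp
  ring

lemma exists_rpow_sub_one_eq_mul_integral {r : ℝ} (hr : r ∈ Ioo (0 : ℝ) 1) :
    ∃ c > 0, ∀ x : ℝ, 0 < x →
      x ^ r - 1 = c * ∫ t, (x - 1) / (t + (1 - t) * x) ∂betaMeasure (1 + r) (1 - r) := by
  set I := ∫ u in Ioi (0 : ℝ), r.rpowIntegrand₀₁ u 1
  have hI : 0 < I := Real.integral_rpowIntegrand₀₁_one_pos hr
  have hr₁ : 0 < 1 + r := by linarith [hr.1]
  have hr₂ : 0 < 1 - r := by linarith [hr.2]
  have hbeta := beta_pos hr₁ hr₂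
  refine ⟨I⁻¹ * beta (1 + r) (1 - r), by positivity, fun x hx => ?_⟩
  calc x ^ r - 1 = x ^ r - 1 ^ r := by rw [Real.one_rpow]
    _ = I⁻¹ * ∫ u in Ioi 0, (r.rpowIntegrand₀₁ u x - r.rpowIntegrand₀₁ u 1) := by
        rw [integral_sub (Real.integrableOn_rpowIntegrand₀₁_Ioi hr hx.le)
          (Real.integrableOn_rpowIntegrand₀₁_Ioi hr zero_le_one), mul_sub,
          ← Real.rpow_eq_const_mul_integral hr hx.le,
          ← Real.rpow_eq_const_mul_integral hr zero_le_one]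
    _ = I⁻¹ * ∫ t in Ioo 0 1, t ^ r * (1 - t) ^ (-r) * ((x - 1) / (t + (1 - t) * x)) := by
        rw [setIntegral_Ioi_zero_eq_setIntegral_Ioo, setIntegral_congr_fun measurableSet_Ioo
          fun t ht => rpowIntegrand₀₁_sub_rpowIntegrand₀₁_one r ht hx]
    _ = I⁻¹ * beta (1 + r) (1 - r) *
          ∫ t, (x - 1) / (t + (1 - t) * x) ∂betaMeasure (1 + r) (1 - r) := by
        rw [integral_betaMeasure hr₁ hr₂, mul_assoc, mul_inv_cancel_left₀ hbeta.ne',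
          add_sub_cancel_left, show 1 - r - 1 = -r by ring]

theorem exists_rpow_le_gaussRadau {r : ℝ} (hr : r ∈ Ioo (0 : ℝ) 1) {m : ℕ} (hm : 1 ≤ m) :
    ∃ t w : Fin m → ℝ, (∀ i, 0 < t i ∧ t i ≤ 1) ∧ (∀ i, 0 < w i) ∧
      ∀ x : ℝ, 0 < x → x ^ r ≤ 1 + ∑ i, w i * ((x - 1) / (t i + (1 - t i) * x)) := by
  obtain ⟨n, rfl⟩ := Nat.exists_eq_add_of_le' hm
  obtain ⟨c, hc, hrepr⟩ := exists_rpow_sub_one_eq_mul_integral hr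
  have : IsProbabilityMeasure (betaMeasure (1 + r) (1 - r)) :=
    isProbabilityMeasureBeta (by linarith [hr.1]) (by linarith [hr.2])
  obtain ⟨s, w, hcard, hs, hw, hle⟩ := exists_integral_cauchyKernel_le
    (ae_mem_Ioo_betaMeasure (1 + r) (1 - r)) n
  have hcard' : (insert 1 s).card = n + 1 := by
    rw [Finset.card_insert_of_notMem fun h => (hs 1 h).2.false, hcard]
  let e := (insert 1 s).equivFinOfCardEq hcard'
  refine ⟨fun i => e.symm i, fun i => c * w (e.symm i), fun i => ?_,
    fun i => mul_pos hc (hw _ (e.symm i).2), fun x hx => ?_⟩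
  · rcases Finset.mem_insert.1 (e.symm i).2 with h | h
    · simp [h]
    · exact ⟨(hs _ h).1, (hs _ h).2.le⟩
  rcases eq_or_ne x 1 with rfl | hx₁
  · simp
  have hx₁' : x - 1 ≠ 0 := sub_ne_zero.2 hx₁
  have hz : x / (x - 1) < 0 ∨ 1 < x / (x - 1) :=
    (lt_or_gt_of_ne hx₁').imp (div_neg_of_pos_of_neg hx) fun h => (one_lt_div h).2 (by linarith)
  have hkernel : ∀ t : ℝ, (x - 1) / (t + (1 - t) * x) = (x / (x - 1) - t)⁻¹ := fun t => by
    rw [← inv_div]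
    congr 1
    field_simp
    ring
  rw [← sub_le_iff_le_add', hrepr x hx]
  simp only [hkernel, mul_assoc, ← Finset.mul_sum]
  refine mul_le_mul_of_nonneg_left ((hle _ hz).trans_eq ?_) hc.le
  rw [e.symm.sum_comp fun t : ↥(insert 1 s) => w t * (x / (x - 1) - t)⁻¹,
    Finset.sum_coe_sort (insert 1 s) fun t => w t * (x / (x - 1) - t)⁻¹]

end RationalBound

section BlockDiagonal

variable {n ι : Type*} [Fintype n]

open scoped MatrixOrder Matrix.Norms.L2Operator in
lemma exists_eq_conjTranspose_mul_self {B : Matrix n n ℂ} (hB : B.PosSemidef) :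
    ∃ C : Matrix n n ℂ, B = Cᴴ * C := by
  classical
  exact CStarAlgebra.nonneg_iff_eq_star_mul_self.mp hB.nonneg

lemma trace_mul_nonneg {A B : Matrix n n ℂ} (hA : A.PosSemidef) (hB : B.PosSemidef) :
    0 ≤ (A * B).trace.re := by
  obtain ⟨C, rfl⟩ := exists_eq_conjTranspose_mul_self hB
  rw [← mul_assoc, Matrix.trace_mul_comm, ← mul_assoc]
  exact (Complex.nonneg_iff.1 (hA.mul_mul_conjTranspose_same C).trace_nonneg).1

lemma dominated_of_posSemidef_sub {A B : Matrix n n ℂ} (hA : A.PosSemidef)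
    (hAB : (B - A).PosSemidef) : Dominated A B := by
  intro v hv
  have h := hAB.dotProduct_mulVec_nonneg v
  rw [Matrix.sub_mulVec, hv, zero_sub, dotProduct_neg, Left.nonneg_neg_iff] at h
  exact (hA.dotProduct_mulVec_zero_iff v).1 (h.antisymm (hA.dotProduct_mulVec_nonneg v))

lemma posSemidef_sum_sub {m : Type*} {s : Finset ι} {A : ι → Matrix m m ℂ}
    (hA : ∀ i ∈ s, (A i).PosSemidef) {i : ι} (hi : i ∈ s) : (∑ j ∈ s, A j - A i).PosSemidef := by
  classical
  rw [← Finset.add_sum_erase _ _ hi, add_sub_cancel_left]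
  exact Matrix.posSemidef_sum _ fun j hj => hA j (Finset.mem_of_mem_erase hj)

variable [DecidableEq n]

lemma mpow_smul {A : Matrix n n ℂ} (hA : A.PosSemidef) {c : ℝ} (hc : 0 ≤ c) (s : ℝ) :
    mpow (c • A) s = c ^ s • mpow A s := by
  have hfin := A.finite_real_spectrum
  rw [mpow, mpow, ← cfc_comp_smul c _ A ((hfin.image _).continuousOn _) hA.1.isSelfAdjoint,
    ← cfc_smul (c ^ s) _ A (hfin.continuousOn _)]
  refine cfc_congr fun x hx => ?_
  rw [hA.1.spectrum_real_eq_range_eigenvalues] at hx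
  obtain ⟨i, rfl⟩ := hx
  exact Real.mul_rpow hc (hA.eigenvalues_nonneg i)

lemma petzTrace_smul_smul {A B : Matrix n n ℂ} (hA : A.PosSemidef) (hB : B.PosSemidef)
    (α : ℝ) {c : ℝ} (hc : 0 ≤ c) : petzTrace α (c • A) (c • B) = c * petzTrace α A B := by
  have hc_rpow : c ^ α * c ^ (1 - α) = c := by
    rw [← Real.rpow_add' hc (by simp), add_sub_cancel, Real.rpow_one]
  rw [petzTrace, petzTrace, mpow_smul hA hc, mpow_smul hB hc, smul_mul_smul_comm,
    Matrix.trace_smul, Complex.smul_re, hc_rpow, smul_eq_mul]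

lemma petzTrace_zero_left {α : ℝ} (hα : α ≠ 0) (B : Matrix n n ℂ) : petzTrace α 0 B = 0 := by
  have h : mpow (0 : Matrix n n ℂ) α = 0 := by
    simpa [Real.zero_rpow hα] using mpow_smul (A := 0) Matrix.PosSemidef.zero le_rfl α
  rw [petzTrace, h, zero_mul, Matrix.trace_zero, Complex.zero_re]

variable [Fintype ι] [DecidableEq ι]

/-- The block diagonal operator `∑ i, |i⟩⟨i| ⊗ B i`, with the classical register in first position;
it is bundled as an algebra homomorphism in the family `B` of its blocks. -/
noncomputable def directSum : (ι → Matrix n n ℂ) →ₐ[ℝ] Matrix (ι × n) (ι × n) ℂ :=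
  (Matrix.reindexAlgEquiv ℝ ℂ (Equiv.prodComm n ι)).toAlgHom.comp
    { Matrix.blockDiagonalRingHom n ι ℂ with
      commutes' := fun r => by
        simp [Algebra.algebraMap_eq_smul_one, Matrix.blockDiagonal_smul] }

lemma directSum_apply (B : ι → Matrix n n ℂ) (i j : ι × n) :
    directSum B i j = if i.1 = j.1 then B i.1 i.2 j.2 else 0 := rfl

lemma trace_directSum (B : ι → Matrix n n ℂ) : (directSum B).trace = ∑ i, (B i).trace := by
  simp [Matrix.trace, directSum_apply, Fintype.sum_prod_type]

lemma traceLeft_directSum (B : ι → Matrix n n ℂ) : traceLeft (directSum B) = ∑ i, B i := by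
  ext k l
  simp [traceLeft, directSum_apply, Matrix.sum_apply]

lemma one_kronecker_eq_directSum (A : Matrix n n ℂ) :
    (1 : Matrix ι ι ℂ) ⊗ₖ A = directSum fun _ => A := by
  ext ⟨i, k⟩ ⟨j, l⟩
  simp [directSum_apply, Matrix.one_apply]

lemma ketbra_kronecker_eq_directSum (i : ι) (A : Matrix n n ℂ) :
    ketbra i ⊗ₖ A = directSum (Pi.single i A) := by
  ext ⟨j, k⟩ ⟨j', l⟩
  by_cases hj : i = j
  · subst hj
    simp [directSum_apply, ketbra, Matrix.single_apply]
  · simp [directSum_apply, ketbra, hj]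

lemma conjTranspose_directSum (B : ι → Matrix n n ℂ) :
    (directSum B)ᴴ = directSum fun i => (B i)ᴴ := by
  ext ⟨i, k⟩ ⟨j, l⟩
  by_cases h : i = j
  · subst h
    simp [directSum_apply]
  · simp [directSum_apply, h, Ne.symm h]

lemma isHermitian_directSum {B : ι → Matrix n n ℂ} (hB : ∀ i, (B i).IsHermitian) :
    (directSum B).IsHermitian := by
  rw [Matrix.IsHermitian, conjTranspose_directSum]
  exact congrArg _ (funext hB)

lemma posSemidef_directSum {B : ι → Matrix n n ℂ} (hB : ∀ i, (B i).PosSemidef) :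
    (directSum B).PosSemidef := by
  choose C hC using fun i => exists_eq_conjTranspose_mul_self (hB i)
  have h : directSum B = (directSum C)ᴴ * directSum C := by
    rw [conjTranspose_directSum, ← map_mul]
    exact congrArg _ (funext hC)
  exact h ▸ Matrix.posSemidef_conjTranspose_mul_self _

open Polynomial in
lemma cfc_directSum {B : ι → Matrix n n ℂ} (hB : ∀ i, (B i).IsHermitian) (f : ℝ → ℝ) :
    cfc f (directSum B) = directSum fun i => cfc f (B i) := by
  have hfin : (spectrum ℝ (directSum B) ∪ ⋃ i, spectrum ℝ (B i)).Finite :=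
    Matrix.finite_real_spectrum.union (Set.finite_iUnion fun i => Matrix.finite_real_spectrum)
  obtain ⟨p, hp⟩ : ∃ p : ℝ[X], ∀ x ∈ spectrum ℝ (directSum B) ∪ ⋃ i, spectrum ℝ (B i),
      f x = p.eval x :=
    ⟨Lagrange.interpolate hfin.toFinset id f, fun x hx =>
      (Lagrange.eval_interpolate_at_node (v := id) _ Function.injective_id.injOn
        (hfin.mem_toFinset.2 hx)).symm⟩
  have hblock : ∀ i, cfc f (B i) = aeval B p i := fun i => by
    rw [cfc_congr fun x hx => hp x (Or.inr (Set.mem_iUnion.2 ⟨i, hx⟩)),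
      cfc_polynomial p _ (hB i).isSelfAdjoint]
    exact aeval_algHom_apply (Pi.evalAlgHom ℝ (fun _ : ι => Matrix n n ℂ) i) B p
  rw [cfc_congr fun x hx => hp x (Or.inl hx),
    cfc_polynomial p _ (isHermitian_directSum hB).isSelfAdjoint, aeval_algHom_apply]
  exact congrArg _ (funext fun i => (hblock i).symm)

lemma petzTrace_directSum {A B : ι → Matrix n n ℂ} (hA : ∀ i, (A i).IsHermitian)
    (hB : ∀ i, (B i).IsHermitian) (α : ℝ) :
    petzTrace α (directSum A) (directSum B) = ∑ i, petzTrace α (A i) (B i) := by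
  simp only [petzTrace, mpow, cfc_directSum hA, cfc_directSum hB, ← map_mul, trace_directSum,
    Complex.re_sum, Pi.mul_apply]

end BlockDiagonal

section Spectral

variable {n : Type*} [Fintype n] [DecidableEq n] {ρ τ : Matrix n n ℂ}
  (hρ : ρ.IsHermitian) (hτ : τ.IsHermitian)

/-- The overlaps `⟨v_k|u_j⟩` of the eigenvectors `v_k` of `τ` with the eigenvectors `u_j` of `ρ`. -/
noncomputable def overlap : Matrix n n ℂ :=
  (hτ.eigenvectorUnitary : Matrix n n ℂ)ᴴ * (hρ.eigenvectorUnitary : Matrix n n ℂ)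

/-- The sum of `f` over the pairs of eigenvalues `l` of `ρ` and `u` of `τ`, weighted by the squared
overlaps of the eigenvectors (the Nussbaum–Szkoła weights of the pair `ρ, τ`). -/
noncomputable def nussbaumSzkolaSum (f : ℝ → ℝ → ℝ) : ℝ :=
  ∑ k, ∑ j, Complex.normSq (overlap hρ hτ k j) * f (hρ.eigenvalues j) (hτ.eigenvalues k)

/-- The operator `∑ k j, z l_j u_k • |v_k⟩⟨v_k|u_j⟩⟨u_j|`, where `l_j, u_j` and `u_k, v_k` are the
eigenvalues and eigenvectors of `ρ` and of `τ` respectively. -/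
noncomputable def doubleOperatorSum (z : ℝ → ℝ → ℝ) : Matrix n n ℂ :=
  (hτ.eigenvectorUnitary : Matrix n n ℂ) *
    Matrix.of (fun k j => (z (hρ.eigenvalues j) (hτ.eigenvalues k) : ℂ) * overlap hρ hτ k j) *
    (hρ.eigenvectorUnitary : Matrix n n ℂ)ᴴ

include hρ in
lemma cfc_eq_conj_diagonal (f : ℝ → ℝ) :
    cfc f ρ = (hρ.eigenvectorUnitary : Matrix n n ℂ) *
      Matrix.diagonal (fun i => (f (hρ.eigenvalues i) : ℂ)) *
      (hρ.eigenvectorUnitary : Matrix n n ℂ)ᴴ := by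
  rw [hρ.cfc_eq, Matrix.IsHermitian.cfc, Unitary.conjStarAlgAut_apply]
  rfl

lemma conjTranspose_mul_self_eigenvectorUnitary :
    (hρ.eigenvectorUnitary : Matrix n n ℂ)ᴴ * (hρ.eigenvectorUnitary : Matrix n n ℂ) = 1 :=
  Unitary.coe_star_mul_self hρ.eigenvectorUnitary

lemma self_mul_conjTranspose_eigenvectorUnitary :
    (hρ.eigenvectorUnitary : Matrix n n ℂ) * (hρ.eigenvectorUnitary : Matrix n n ℂ)ᴴ = 1 :=
  Unitary.coe_mul_star_self hρ.eigenvectorUnitary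

lemma doubleOperatorSum_one : doubleOperatorSum hρ hτ (fun _ _ => 1) = 1 := by
  have h : Matrix.of (fun k j => ((1 : ℝ) : ℂ) * overlap hρ hτ k j) = overlap hρ hτ := by
    ext; simp
  rw [doubleOperatorSum, h, overlap, ← mul_assoc, self_mul_conjTranspose_eigenvectorUnitary,
    one_mul, self_mul_conjTranspose_eigenvectorUnitary]

lemma cfc_mul_doubleOperatorSum (g : ℝ → ℝ) (z : ℝ → ℝ → ℝ) :
    cfc g τ * doubleOperatorSum hρ hτ z = doubleOperatorSum hρ hτ fun l u => g u * z l u := by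
  simp only [doubleOperatorSum, cfc_eq_conj_diagonal hτ, ← mul_assoc]
  rw [mul_assoc _ _ (hτ.eigenvectorUnitary : Matrix n n ℂ),
    conjTranspose_mul_self_eigenvectorUnitary, mul_one,
    mul_assoc (hτ.eigenvectorUnitary : Matrix n n ℂ)]
  congr 3
  ext k j
  simp [mul_assoc]

lemma doubleOperatorSum_mul_cfc (f : ℝ → ℝ) (z : ℝ → ℝ → ℝ) :
    doubleOperatorSum hρ hτ z * cfc f ρ = doubleOperatorSum hρ hτ fun l u => f l * z l u := by
  simp only [doubleOperatorSum, cfc_eq_conj_diagonal hρ, ← mul_assoc]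
  rw [mul_assoc _ _ (hρ.eigenvectorUnitary : Matrix n n ℂ),
    conjTranspose_mul_self_eigenvectorUnitary, mul_one,
    mul_assoc (hτ.eigenvectorUnitary : Matrix n n ℂ)]
  congr 3
  ext k j
  simp [mul_comm, mul_left_comm]

lemma self_mul_doubleOperatorSum (z : ℝ → ℝ → ℝ) :
    τ * doubleOperatorSum hρ hτ z = doubleOperatorSum hρ hτ fun l u => u * z l u := by
  simpa only [cfc_id' ℝ τ hτ.isSelfAdjoint] using cfc_mul_doubleOperatorSum hρ hτ (fun u => u) z

lemma doubleOperatorSum_mul_self (z : ℝ → ℝ → ℝ) :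
    doubleOperatorSum hρ hτ z * ρ = doubleOperatorSum hρ hτ fun l u => l * z l u := by
  simpa only [cfc_id' ℝ ρ hρ.isSelfAdjoint] using doubleOperatorSum_mul_cfc hρ hτ (fun l => l) z

lemma trace_conjTranspose_doubleOperatorSum_mul (x z : ℝ → ℝ → ℝ) :
    ((doubleOperatorSum hρ hτ x)ᴴ * doubleOperatorSum hρ hτ z).trace.re =
      nussbaumSzkolaSum hρ hτ fun l u => x l u * z l u := by
  simp only [doubleOperatorSum, Matrix.conjTranspose_mul, Matrix.conjTranspose_conjTranspose]
  rw [mul_assoc, Matrix.trace_mul_comm, mul_assoc, mul_assoc, mul_assoc,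
    conjTranspose_mul_self_eigenvectorUnitary, mul_one, ← mul_assoc _ _ (Matrix.of _),
    conjTranspose_mul_self_eigenvectorUnitary, one_mul, nussbaumSzkolaSum, Finset.sum_comm]
  simp only [Matrix.trace, Matrix.diag, Matrix.mul_apply, Complex.re_sum]
  refine Finset.sum_congr rfl fun j _ => Finset.sum_congr rfl fun k _ => ?_
  simp only [Matrix.conjTranspose_apply, Matrix.of_apply, star_mul', Complex.star_def,
    Complex.conj_ofReal, Complex.mul_re, Complex.mul_im, Complex.ofReal_re, Complex.ofReal_im,
    Complex.conj_re, Complex.conj_im, Complex.normSq_apply]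
  ring

lemma petzTrace_eq_nussbaumSzkolaSum (α : ℝ) :
    petzTrace α ρ τ = nussbaumSzkolaSum hρ hτ fun l u => l ^ α * u ^ (1 - α) := by
  have h : mpow τ (1 - α) * mpow ρ α = (doubleOperatorSum hρ hτ fun _ _ => 1)ᴴ *
      doubleOperatorSum hρ hτ fun l u => l ^ α * (u ^ (1 - α) * 1) := by
    rw [← doubleOperatorSum_mul_cfc, ← cfc_mul_doubleOperatorSum, doubleOperatorSum_one,
      Matrix.conjTranspose_one, one_mul, mul_one]
    rfl
  rw [petzTrace, Matrix.trace_mul_comm, h, trace_conjTranspose_doubleOperatorSum_mul]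
  simp only [one_mul, mul_one]

lemma trace_mul_conjTranspose_doubleOperatorSum_mul (x z : ℝ → ℝ → ℝ) :
    (ρ * ((doubleOperatorSum hρ hτ x)ᴴ * doubleOperatorSum hρ hτ z)).trace.re =
      nussbaumSzkolaSum hρ hτ fun l u => l * (x l u * z l u) := by
  rw [Matrix.trace_mul_comm, mul_assoc, doubleOperatorSum_mul_self,
    trace_conjTranspose_doubleOperatorSum_mul]
  simp only [mul_left_comm]

lemma trace_mul_doubleOperatorSum_mul_conjTranspose (z : ℝ → ℝ → ℝ) :
    (τ * (doubleOperatorSum hρ hτ z * (doubleOperatorSum hρ hτ z)ᴴ)).trace.re =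
      nussbaumSzkolaSum hρ hτ fun l u => u * z l u ^ 2 := by
  rw [← mul_assoc, Matrix.trace_mul_comm, self_mul_doubleOperatorSum,
    trace_conjTranspose_doubleOperatorSum_mul]
  simp only [mul_left_comm, sq]

lemma re_trace_eq_nussbaumSzkolaSum : ρ.trace.re = nussbaumSzkolaSum hρ hτ fun l _ => l := by
  simpa [doubleOperatorSum_one] using
    trace_mul_conjTranspose_doubleOperatorSum_mul hρ hτ (fun _ _ => 1) fun _ _ => 1

lemma nussbaumSzkolaSum_sub_sum {m : ℕ} (f : ℝ → ℝ → ℝ) (c : Fin m → ℝ)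
    (g : Fin m → ℝ → ℝ → ℝ) :
    (nussbaumSzkolaSum hρ hτ fun l u => f l u - ∑ i, c i * g i l u) =
      nussbaumSzkolaSum hρ hτ f - ∑ i, c i * nussbaumSzkolaSum hρ hτ (g i) := by
  simp only [nussbaumSzkolaSum, mul_sub, Finset.sum_sub_distrib, Finset.mul_sum, mul_left_comm]
  rw [Finset.sum_comm_cycle]

lemma overlap_eq_zero_of_dominated (hd : Dominated ρ τ) {k j : n} (hk : hτ.eigenvalues k = 0)
    (hj : hρ.eigenvalues j ≠ 0) : overlap hρ hτ k j = 0 := by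
  set v : n → ℂ := ⇑(hτ.eigenvectorBasis k)
  set u : n → ℂ := ⇑(hρ.eigenvectorBasis j)
  have hρv : ρ *ᵥ v = 0 := hd v (by rw [hτ.mulVec_eigenvectorBasis, hk, zero_smul])
  have hmul : (hρ.eigenvalues j : ℂ) * (star v ⬝ᵥ u) = 0 := by
    calc (hρ.eigenvalues j : ℂ) * (star v ⬝ᵥ u) = star v ⬝ᵥ (ρ *ᵥ u) := by
          rw [hρ.mulVec_eigenvectorBasis, dotProduct_smul, Complex.real_smul]
      _ = star (ρ *ᵥ v) ⬝ᵥ u := by rw [Matrix.star_mulVec, hρ.eq, Matrix.dotProduct_mulVec]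
      _ = 0 := by rw [hρv, star_zero, zero_dotProduct]
  exact (mul_eq_zero.1 hmul).resolve_left (Complex.ofReal_ne_zero.2 hj)

lemma nussbaumSzkolaSum_le_of_dominated (hρ : ρ.PosSemidef) (hτ : τ.PosSemidef)
    (hd : Dominated ρ τ) {f g : ℝ → ℝ → ℝ} (h₀ : ∀ u, 0 ≤ u → f 0 u ≤ g 0 u)
    (h : ∀ l u, 0 < l → 0 < u → f l u ≤ g l u) :
    nussbaumSzkolaSum hρ.1 hτ.1 f ≤ nussbaumSzkolaSum hρ.1 hτ.1 g := by
  refine Finset.sum_le_sum fun k _ => Finset.sum_le_sum fun j _ => ?_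
  rcases (hρ.eigenvalues_nonneg j).eq_or_lt with hl | hl
  · rw [← hl]
    exact mul_le_mul_of_nonneg_left (h₀ _ (hτ.eigenvalues_nonneg k)) (Complex.normSq_nonneg _)
  rcases (hτ.eigenvalues_nonneg k).eq_or_lt with hu | hu
  · simp [overlap_eq_zero_of_dominated hρ.1 hτ.1 hd hu.symm hl.ne']
  · exact mul_le_mul_of_nonneg_left (h _ _ hl hu) (Complex.normSq_nonneg _)

end Spectral

section Variational

variable {n : Type*} [Fintype n] [DecidableEq n]

/-- The quadratic functional `Tr[ρ (1 + Z + Z† + (1 - t) Z† Z)] + t Tr[τ Z Z†]` of the operator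
`Z`, of which the objective function is a combination with negative coefficients. -/
noncomputable def quadCost (t : ℝ) (ρ τ Z : Matrix n n ℂ) : ℝ :=
  (ρ * (1 + Z + Zᴴ + (1 - t) • (Zᴴ * Z))).trace.re + t * (τ * (Z * Zᴴ)).trace.re

/-- The quadratic functional `quadCost` on a one-dimensional system, for a real `z`. -/
def scalarCost (t l u z : ℝ) : ℝ := l * (1 + 2 * z + (1 - t) * z ^ 2) + t * (u * z ^ 2)

/-- The critical point of `scalarCost t l u`. -/
noncomputable def scalarCostArgmin (t l u : ℝ) : ℝ := -l / ((1 - t) * l + t * u)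

lemma quadCost_doubleOperatorSum {ρ τ : Matrix n n ℂ} (hρ : ρ.IsHermitian) (hτ : τ.IsHermitian)
    (t : ℝ) (z : ℝ → ℝ → ℝ) :
    quadCost t ρ τ (doubleOperatorSum hρ hτ z) =
      nussbaumSzkolaSum hρ hτ fun l u => scalarCost t l u (z l u) := by
  have hZ := trace_mul_conjTranspose_doubleOperatorSum_mul hρ hτ (fun _ _ => 1) z
  have hZ_star := trace_mul_conjTranspose_doubleOperatorSum_mul hρ hτ z fun _ _ => 1
  simp only [doubleOperatorSum_one, Matrix.conjTranspose_one, one_mul, mul_one] at hZ hZ_star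
  simp only [quadCost, mul_add, mul_one, Matrix.trace_add, Complex.add_re, Matrix.mul_smul,
    Matrix.trace_smul, Complex.smul_re, smul_eq_mul]
  rw [re_trace_eq_nussbaumSzkolaSum hρ hτ, hZ, hZ_star,
    trace_mul_conjTranspose_doubleOperatorSum_mul,
    trace_mul_doubleOperatorSum_mul_conjTranspose]
  simp only [nussbaumSzkolaSum, scalarCost, Finset.mul_sum, ← Finset.sum_add_distrib]
  exact Finset.sum_congr rfl fun k _ => Finset.sum_congr rfl fun j _ => by ring

lemma scalarCost_scalarCostArgmin {t l u : ℝ} (hD : (1 - t) * l + t * u ≠ 0) :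
    scalarCost t l u (scalarCostArgmin t l u) = t * (l * (u - l) / ((1 - t) * l + t * u)) := by
  rw [scalarCost, scalarCostArgmin]
  generalize hD' : (1 - t) * l + t * u = D at *
  field_simp
  linear_combination l * (l - D) * hD'

lemma rpow_mul_rpow_one_sub {l u : ℝ} (hl : 0 < l) (hu : 0 < u) (α : ℝ) :
    l ^ α * u ^ (1 - α) = l * (l / u) ^ (α - 1) := by
  rw [Real.div_rpow hl.le hu.le, ← neg_sub α 1, Real.rpow_neg hu.le, Real.rpow_sub_one hl.ne']
  field_simp

lemma rpow_mul_rpow_le_of_rpow_le {α : ℝ} {m : ℕ} {t w : Fin m → ℝ} (ht : ∀ i, 0 < t i ∧ t i ≤ 1)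
    (h : ∀ x : ℝ, 0 < x → x ^ (α - 1) ≤ 1 + ∑ i, w i * ((x - 1) / (t i + (1 - t i) * x)))
    {l u : ℝ} (hl : 0 < l) (hu : 0 < u) :
    l ^ α * u ^ (1 - α) ≤
      l - ∑ i, w i / t i * scalarCost (t i) l u (scalarCostArgmin (t i) l u) := by
  calc l ^ α * u ^ (1 - α) = l * (l / u) ^ (α - 1) := rpow_mul_rpow_one_sub hl hu α
    _ ≤ l * (1 + ∑ i, w i * ((l / u - 1) / (t i + (1 - t i) * (l / u)))) :=
        mul_le_mul_of_nonneg_left (h _ (div_pos hl hu)) hl.le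
    _ = _ := by
        rw [mul_one_add, Finset.mul_sum, sub_eq_add_neg l, ← Finset.sum_neg_distrib]
        congr 1
        refine Finset.sum_congr rfl fun i _ => ?_
        have hti := (ht i).1
        have hD : 0 < (1 - t i) * l + t i * u :=
          add_pos_of_nonneg_of_pos (mul_nonneg (sub_nonneg.2 (ht i).2) hl.le) (mul_pos hti hu)
        have : 0 < t i * u + (1 - t i) * l := by rwa [add_comm]
        rw [scalarCost_scalarCostArgmin hD.ne']
        field_simp
        ring

lemma exists_petzTrace_le {α : ℝ} (hα : α ≠ 0) {m : ℕ} {t w : Fin m → ℝ}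
    (ht : ∀ i, 0 < t i ∧ t i ≤ 1)
    (h : ∀ x : ℝ, 0 < x → x ^ (α - 1) ≤ 1 + ∑ i, w i * ((x - 1) / (t i + (1 - t i) * x)))
    {ρ τ : Matrix n n ℂ} (hρ : ρ.PosSemidef) (hτ : τ.PosSemidef) (hd : Dominated ρ τ) :
    ∃ Z : Fin m → Matrix n n ℂ,
      petzTrace α ρ τ ≤ ρ.trace.re - ∑ i, w i / t i * quadCost (t i) ρ τ (Z i) := by
  refine ⟨fun i => doubleOperatorSum hρ.1 hτ.1 (scalarCostArgmin (t i)), ?_⟩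
  rw [petzTrace_eq_nussbaumSzkolaSum hρ.1 hτ.1, re_trace_eq_nussbaumSzkolaSum hρ.1 hτ.1]
  simp only [quadCost_doubleOperatorSum]
  rw [← nussbaumSzkolaSum_sub_sum]
  refine nussbaumSzkolaSum_le_of_dominated hρ hτ hd (fun u _ => ?_) fun l u hl hu =>
    rpow_mul_rpow_le_of_rpow_le ht h hl hu
  simp [scalarCost, scalarCostArgmin, Real.zero_rpow hα]

lemma trace_polyP_add_trace_polyQ {m : ℕ} (α : ℝ) {t : Fin m → ℝ} (ht : ∀ i, t i ≠ 0)
    (w : Fin m → ℝ) (ρ τ : Matrix n n ℂ) (Z : Fin m → Matrix n n ℂ) :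
    (ρ * polyP α t w Z).trace.re + (τ * polyQ α w Z).trace.re =
      ρ.trace.re + Real.sin (α * Real.pi) / Real.pi *
        ∑ i, w i / t i * quadCost (t i) ρ τ (Z i) := by
  simp only [polyP, polyQ, mul_add, mul_one, Matrix.mul_smul, Matrix.trace_add, Matrix.trace_smul,
    Complex.add_re, Complex.smul_re, Matrix.mul_sum, Matrix.trace_sum, Complex.re_sum, quadCost,
    smul_eq_mul]
  rw [add_assoc, ← mul_add, ← Finset.sum_add_distrib]
  congr 2
  refine Finset.sum_congr rfl fun i _ => ?_
  rw [← mul_assoc (w i / t i) (t i), div_mul_cancel₀ _ (ht i)]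

-- With `Y = Z + t⁻¹`, `quadCost t ρ τ Z` exceeds the bound by
-- `t Tr[ρ Y Y†] + t Tr[(τ - ρ) Z Z†] + (1 - t) Tr[ρ Z† Z]`.
lemma le_quadCost {t : ℝ} (ht : 0 < t) (ht1 : t ≤ 1) {ρ τ : Matrix n n ℂ} (hρ : ρ.PosSemidef)
    (hτ : (τ - ρ).PosSemidef) (Z : Matrix n n ℂ) :
    (1 - t⁻¹) * ρ.trace.re ≤ quadCost t ρ τ Z := by
  set Y := Z + t⁻¹ • (1 : Matrix n n ℂ) with hY
  have hYY : Y * Yᴴ = Z * Zᴴ + t⁻¹ • (Z + Zᴴ) + (t⁻¹ * t⁻¹) • (1 : Matrix n n ℂ) := by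
    simp only [hY, Matrix.conjTranspose_add, Matrix.conjTranspose_smul, star_trivial,
      Matrix.conjTranspose_one, add_mul, mul_add, smul_mul_assoc, mul_smul_comm, mul_one, one_mul,
      smul_add, smul_smul]
    abel
  have hρYY := mul_nonneg ht.le <|
    trace_mul_nonneg hρ (Matrix.posSemidef_self_mul_conjTranspose Y)
  have hτZZ := mul_nonneg ht.le <|
    trace_mul_nonneg hτ (Matrix.posSemidef_self_mul_conjTranspose Z)
  have hρZZ := mul_nonneg (sub_nonneg.2 ht1) <|
    trace_mul_nonneg hρ (Matrix.posSemidef_conjTranspose_mul_self Z)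
  suffices h : quadCost t ρ τ Z - (1 - t⁻¹) * ρ.trace.re = t * (ρ * (Y * Yᴴ)).trace.re +
      t * ((τ - ρ) * (Z * Zᴴ)).trace.re + (1 - t) * (ρ * (Zᴴ * Z)).trace.re by linarith
  simp only [hYY, quadCost, sub_mul, mul_add, Matrix.trace_add, Matrix.trace_sub, Complex.add_re,
    Complex.sub_re, Matrix.mul_smul, Matrix.trace_smul, Complex.smul_re, mul_one, smul_eq_mul]
  field_simp
  ring

end Variational

section PartialTrace

variable {m n ι : Type*}

lemma sum_kronecker (s : Finset ι) (A : ι → Matrix m m ℂ) (B : Matrix n n ℂ) :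
    (∑ i ∈ s, A i) ⊗ₖ B = ∑ i ∈ s, A i ⊗ₖ B := by
  ext i j
  simp [Matrix.sum_apply, Finset.sum_mul]

lemma kronecker_sum (s : Finset ι) (A : Matrix m m ℂ) (B : ι → Matrix n n ℂ) :
    A ⊗ₖ (∑ i ∈ s, B i) = ∑ i ∈ s, A ⊗ₖ B i := by
  ext i j
  simp [Matrix.sum_apply, Finset.mul_sum]

variable [Fintype m]

lemma trace_ketbra [DecidableEq m] (k : m) : (ketbra k).trace = 1 :=
  Matrix.trace_single_eq_same k 1

lemma traceLeft_sum (s : Finset ι) (R : ι → Matrix (m × n) (m × n) ℂ) :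
    traceLeft (∑ i ∈ s, R i) = ∑ i ∈ s, traceLeft (R i) := by
  ext k l
  simp only [traceLeft, Matrix.sum_apply]
  exact Finset.sum_comm

lemma traceLeft_smul (c : ℂ) (R : Matrix (m × n) (m × n) ℂ) :
    traceLeft (c • R) = c • traceLeft R := by
  ext k l
  simp [traceLeft, Finset.mul_sum]

lemma traceLeft_kronecker (A : Matrix m m ℂ) (B : Matrix n n ℂ) :
    traceLeft (A ⊗ₖ B) = A.trace • B := by
  ext k l
  simp [traceLeft, Matrix.trace, Finset.sum_mul]

lemma traceLeft_eq_sum_partialState (R : Matrix (m × n) (m × n) ℂ) :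
    traceLeft R = ∑ k, partialState R k := by
  ext i j
  simp [traceLeft, partialState, Matrix.sum_apply]

lemma posSemidef_traceLeft {R : Matrix (m × n) (m × n) ℂ} (hR : R.PosSemidef) :
    (traceLeft R).PosSemidef := by
  rw [traceLeft_eq_sum_partialState]
  exact Matrix.posSemidef_sum _ fun k _ => hR.submatrix fun i => (k, i)

variable [Fintype n]

lemma trace_traceLeft (R : Matrix (m × n) (m × n) ℂ) : (traceLeft R).trace = R.trace := by
  simp only [Matrix.trace, Matrix.diag, traceLeft, Fintype.sum_prod_type]
  exact Finset.sum_comm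

lemma traceLeft_mul_one_kronecker [DecidableEq m] (R : Matrix (m × n) (m × n) ℂ)
    (B : Matrix n n ℂ) : traceLeft (R * ((1 : Matrix m m ℂ) ⊗ₖ B)) = traceLeft R * B := by
  ext i j
  simp only [traceLeft, Matrix.mul_apply, Fintype.sum_prod_type, Matrix.kronecker_apply,
    Matrix.one_apply, Finset.sum_mul]
  rw [Finset.sum_comm (s := Finset.univ (α := n))]
  refine Finset.sum_congr rfl fun k _ => ?_
  rw [Finset.sum_eq_single k (fun k' _ hk' => by simp [hk']) (by simp)]
  simp

lemma trace_traceLeft_mul [DecidableEq m] (R : Matrix (m × n) (m × n) ℂ) (B : Matrix n n ℂ) :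
    (traceLeft R * B).trace = (R * ((1 : Matrix m m ℂ) ⊗ₖ B)).trace := by
  rw [← traceLeft_mul_one_kronecker, trace_traceLeft]

lemma traceLeft_kronecker_one_mul [DecidableEq n] (A : Matrix m m ℂ)
    (R : Matrix (m × n) (m × n) ℂ) :
    traceLeft ((A ⊗ₖ (1 : Matrix n n ℂ)) * R) = traceLeft (R * (A ⊗ₖ (1 : Matrix n n ℂ))) := by
  ext i j
  simp only [traceLeft, Matrix.mul_apply, Fintype.sum_prod_type, Matrix.kronecker_apply,
    Matrix.one_apply, mul_ite, mul_one, mul_zero, ite_mul, zero_mul, Finset.sum_ite_eq,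
    Finset.sum_ite_eq', Finset.mem_univ, if_true]
  rw [Finset.sum_comm]
  simp only [mul_comm]

lemma posSemidef_traceLeft_kronecker_one_mul [DecidableEq n] {A : Matrix m m ℂ}
    (hA : A.PosSemidef) {R : Matrix (m × n) (m × n) ℂ} (hR : R.PosSemidef) :
    (traceLeft ((A ⊗ₖ (1 : Matrix n n ℂ)) * R)).PosSemidef := by
  obtain ⟨C, rfl⟩ := exists_eq_conjTranspose_mul_self hA
  have hC : (C ⊗ₖ (1 : Matrix n n ℂ))ᴴ = Cᴴ ⊗ₖ (1 : Matrix n n ℂ) := by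
    rw [Matrix.conjTranspose_kronecker, Matrix.conjTranspose_one]
  have hmul : (Cᴴ * C) ⊗ₖ (1 : Matrix n n ℂ) = (Cᴴ ⊗ₖ 1) * (C ⊗ₖ 1) := by
    rw [← Matrix.mul_kronecker_mul, one_mul]
  rw [hmul, mul_assoc, traceLeft_kronecker_one_mul, ← hC]
  exact posSemidef_traceLeft (hR.mul_mul_conjTranspose_same _)

lemma trace_mul_kronecker_one_kronecker {k : Type*} [Fintype k] [DecidableEq n] [DecidableEq k]
    (R : Matrix (m × n × k) (m × n × k) ℂ) (A : Matrix m m ℂ) (B : Matrix k k ℂ) :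
    (R * (A ⊗ₖ ((1 : Matrix n n ℂ) ⊗ₖ B))).trace =
      (traceLeft (traceLeft ((A ⊗ₖ ((1 : Matrix n n ℂ) ⊗ₖ (1 : Matrix k k ℂ))) * R)) *
        B).trace := by
  classical
  rw [trace_traceLeft_mul, trace_traceLeft_mul, mul_assoc, Matrix.trace_mul_comm (A ⊗ₖ _),
    mul_assoc, ← Matrix.mul_kronecker_mul, ← Matrix.mul_kronecker_mul, one_mul, one_mul, mul_one]

lemma dominated_one_kronecker_traceLeft_directSum [DecidableEq m] [DecidableEq n]
    {A : m → Matrix n n ℂ} (hA : ∀ i, (A i).PosSemidef) :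
    Dominated (directSum A) ((1 : Matrix m m ℂ) ⊗ₖ traceLeft (directSum A)) := by
  rw [one_kronecker_eq_directSum, traceLeft_directSum]
  refine dominated_of_posSemidef_sub (posSemidef_directSum hA) ?_
  rw [← map_sub]
  exact posSemidef_directSum fun i => posSemidef_sum_sub (fun j _ => hA j) (Finset.mem_univ i)

end PartialTrace

namespace Protocol

variable {𝒳 𝒴 𝒜 ℬ 𝒞 : Type*} [Fintype 𝒳] [Fintype 𝒴] (p : Protocol 𝒳 𝒴 𝒜 ℬ 𝒞)

lemma sum_testBit_sum_P : ∑ t, ∑ x, ∑ y, p.P x y t = 1 := by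
  rw [← p.P_sum, Finset.sum_comm]
  exact Finset.sum_congr rfl fun x _ => Finset.sum_comm

lemma probXKey_nonneg (x : 𝒳) : 0 ≤ p.probXKey x :=
  div_nonneg (Finset.sum_nonneg fun y _ => p.P_nonneg x y 0)
    (Finset.sum_nonneg fun x _ => Finset.sum_nonneg fun y _ => p.P_nonneg x y 0)

lemma probXKey_eq_zero_of_notMem {x : 𝒳} (hx : x ∉ p.keyX) : p.probXKey x = 0 := by
  have hP : ∀ y, p.P x y 0 = 0 := fun y => not_not.1 fun h => hx (p.P_key x y h).1
  simp only [probXKey, hP, Finset.sum_const_zero, zero_div]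

lemma sum_probXKey (h : p.probKey ≠ 0) : ∑ x, p.probXKey x = 1 := by
  simp only [probXKey, ← Finset.sum_div]
  exact div_self h

end Protocol

namespace Devices

variable {𝒳 𝒴 𝒜 ℬ 𝒞 : Type*} [Fintype 𝒳] [Fintype 𝒴] {p : Protocol 𝒳 𝒴 𝒜 ℬ 𝒞}
  {qA qB e : Type*} [Fintype qA] [Fintype qB] [Fintype e]
  [DecidableEq qA] [DecidableEq qB] [DecidableEq e]
  (d : Devices p qA qB) {σ : Matrix (qA × qB × e) (qA × qB × e) ℂ}

lemma sum_traceLeft_kronecker_N_mul (y : 𝒴) (A : Matrix qA qA ℂ) :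
    ∑ b ∈ p.outB y, traceLeft (traceLeft ((A ⊗ₖ (d.N y b ⊗ₖ (1 : Matrix e e ℂ))) * σ)) =
      traceLeft (traceLeft ((A ⊗ₖ ((1 : Matrix qB qB ℂ) ⊗ₖ (1 : Matrix e e ℂ))) * σ)) := by
  rw [← traceLeft_sum, ← traceLeft_sum, ← Finset.sum_mul, ← kronecker_sum, ← sum_kronecker,
    d.N_sum]

variable (σ) in
open Classical in
/-- Eve's unnormalized state `Tr_{Q_A Q_B}[(M_{a|x} ⊗ 1 ⊗ 1) σ]` given Alice's input `x` and
output `a`, extended by zero to all letters `a` of the common alphabet `𝒜`. -/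
noncomputable def eveState (x : 𝒳) (a : 𝒜) : Matrix e e ℂ :=
  if a ∈ p.outA x then
    traceLeft (traceLeft ((d.M x a ⊗ₖ ((1 : Matrix qB qB ℂ) ⊗ₖ (1 : Matrix e e ℂ))) * σ))
  else 0

lemma eveState_of_mem {x : 𝒳} {a : 𝒜} (ha : a ∈ p.outA x) : d.eveState σ x a =
    traceLeft (traceLeft ((d.M x a ⊗ₖ ((1 : Matrix qB qB ℂ) ⊗ₖ (1 : Matrix e e ℂ))) * σ)) :=
  if_pos ha

lemma eveState_of_notMem {x : 𝒳} {a : 𝒜} (ha : a ∉ p.outA x) : d.eveState σ x a = 0 :=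
  if_neg ha

lemma posSemidef_eveState (hσ : σ.PosSemidef) (x : 𝒳) (a : 𝒜) :
    (d.eveState σ x a).PosSemidef := by
  by_cases ha : a ∈ p.outA x
  · rw [eveState_of_mem d ha, Matrix.one_kronecker_one]
    exact posSemidef_traceLeft (posSemidef_traceLeft_kronecker_one_mul (d.M_pos x a ha) hσ)
  · rw [eveState_of_notMem d ha]
    exact Matrix.PosSemidef.zero

lemma sum_outA_eveState (x : 𝒳) :
    ∑ a ∈ p.outA x, d.eveState σ x a = traceLeft (traceLeft σ) := by
  rw [Finset.sum_congr rfl fun a ha => d.eveState_of_mem ha, ← traceLeft_sum, ← traceLeft_sum,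
    ← Finset.sum_mul, ← sum_kronecker, d.M_sum, Matrix.one_kronecker_one, Matrix.one_kronecker_one,
    one_mul]

lemma posSemidef_traceLeft_sub_eveState (hσ : σ.PosSemidef) (x : 𝒳) (a : 𝒜) :
    (traceLeft (traceLeft σ) - d.eveState σ x a).PosSemidef := by
  by_cases ha : a ∈ p.outA x
  · rw [← sum_outA_eveState d x]
    exact posSemidef_sum_sub (fun a' _ => d.posSemidef_eveState hσ x a') ha
  · rw [eveState_of_notMem d ha, sub_zero]
    exact posSemidef_traceLeft (posSemidef_traceLeft hσ)

section Objective

lemma objective_eq_sum (α : ℝ) {m : ℕ} {t : Fin m → ℝ} (ht : ∀ i, t i ≠ 0) (w : Fin m → ℝ)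
    (x : 𝒳) (Z : 𝒜 → Fin m → Matrix e e ℂ) :
    d.objective σ α t w x Z = ∑ a ∈ p.outA x, ((d.eveState σ x a).trace.re +
      Real.sin (α * Real.pi) / Real.pi *
        ∑ i, w i / t i * quadCost (t i) (d.eveState σ x a) (traceLeft (traceLeft σ)) (Z a i)) := by
  refine Finset.sum_congr rfl fun a ha => ?_
  rw [← trace_polyP_add_trace_polyQ α ht, mul_add, Matrix.trace_add, Complex.add_re,
    trace_mul_kronecker_one_kronecker, trace_mul_kronecker_one_kronecker, eveState_of_mem d ha,
    Matrix.one_kronecker_one, Matrix.one_kronecker_one, one_mul]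

lemma bddAbove_range_objective {α : ℝ} (hα : Real.sin (α * Real.pi) ≤ 0) {m : ℕ}
    {t w : Fin m → ℝ} (ht : ∀ i, 0 < t i ∧ t i ≤ 1) (hw : ∀ i, 0 ≤ w i) (hσ : σ.PosSemidef)
    (x : 𝒳) :
    BddAbove (Set.range fun Z : 𝒜 → Fin m → Matrix e e ℂ => d.objective σ α t w x Z) := by
  refine ⟨∑ a ∈ p.outA x, ((d.eveState σ x a).trace.re + Real.sin (α * Real.pi) / Real.pi *
    ∑ i, w i / t i * ((1 - (t i)⁻¹) * (d.eveState σ x a).trace.re)), ?_⟩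
  rintro _ ⟨Z, rfl⟩
  simp only [objective_eq_sum d α fun i => (ht i).1.ne']
  have hcost : ∀ a i, (1 - (t i)⁻¹) * (d.eveState σ x a).trace.re ≤
      quadCost (t i) (d.eveState σ x a) (traceLeft (traceLeft σ)) (Z a i) := fun a i =>
    le_quadCost (ht i).1 (ht i).2 (d.posSemidef_eveState hσ x a)
      (d.posSemidef_traceLeft_sub_eveState hσ x a) _
  have hweight : ∀ i, 0 ≤ w i / t i := fun i => div_nonneg (hw i) (ht i).1.le
  exact Finset.sum_le_sum fun a _ => add_le_add_right
    (mul_le_mul_of_nonpos_left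
      (Finset.sum_le_sum fun i _ => mul_le_mul_of_nonneg_left (hcost a i) (hweight i))
      (div_nonpos_of_nonpos_of_nonneg hα Real.pi_pos.le)) _

end Objective

lemma output_apply [DecidableEq 𝒳] [DecidableEq 𝒴] [DecidableEq 𝒜] [DecidableEq 𝒞]
    (t : Fin 2) (y : 𝒴) (c : Option 𝒞) (a a' : 𝒜) (x x' : 𝒳) (i j : e) :
    d.output σ (t, y, c, a, x, i) (t, y, c, a', x', j) =
      if x = x' then (p.P x y t : ℂ) * d.roundOutput σ x y t (c, a, i) (c, a', j) else 0 := by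
  simp only [output, ketbra, Matrix.single_apply, and_self]
  rw [Finset.sum_eq_single x (fun _ _ h => by simp [h]) (by simp),
    Finset.sum_eq_single y (fun _ _ h => by simp [h]) (by simp),
    Finset.sum_eq_single t (fun _ _ h => by simp [h]) (by simp)]
  simp

variable [Fintype 𝒜]

lemma sum_eveState (x : 𝒳) : ∑ a, d.eveState σ x a = traceLeft (traceLeft σ) := by
  rw [← sum_outA_eveState d x]
  exact (Finset.sum_subset (Finset.subset_univ _) fun a _ ha => d.eveState_of_notMem ha).symm

lemma sum_trace_eveState (x : 𝒳) : ∑ a, (d.eveState σ x a).trace = σ.trace := by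
  rw [← Matrix.trace_sum, sum_eveState, trace_traceLeft, trace_traceLeft]

variable [DecidableEq 𝒜]

lemma stateAE_eq_directSum (x : 𝒳) : d.stateAE σ x = directSum (d.eveState σ x) := by
  simp only [stateAE, ketbra_kronecker_eq_directSum, ← map_sum]
  congr 1
  ext1 a
  simp only [Finset.sum_apply, Finset.sum_pi_single, eveState]
  congr

section Output

variable [DecidableEq 𝒞] [Fintype 𝒞]

lemma traceLeft_roundOutput (x : 𝒳) (y : 𝒴) (t : Fin 2) :
    traceLeft (d.roundOutput σ x y t) = directSum (d.eveState σ x) := by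
  rw [← stateAE_eq_directSum, stateAE, roundOutput, traceLeft_sum]
  refine Finset.sum_congr rfl fun a _ => ?_
  simp only [traceLeft_sum, traceLeft_kronecker, trace_ketbra, one_smul]
  rw [← kronecker_sum, sum_traceLeft_kronecker_N_mul]

variable [DecidableEq 𝒳] [DecidableEq 𝒴]

lemma traceLeft_partialState_output (t : Fin 2) :
    traceLeft (traceLeft (partialState (d.output σ) t)) =
      directSum fun a => directSum fun x => (∑ y, p.P x y t) • d.eveState σ x a := by
  ext ⟨a, x, i⟩ ⟨a', x', j⟩
  have hround : ∀ y, ∑ c, d.roundOutput σ x y t (c, a, i) (c, a', j) =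
      directSum (d.eveState σ x) (a, i) (a', j) := fun y => by
    rw [← traceLeft_roundOutput d x y t]
    rfl
  simp only [traceLeft, partialState, output_apply]
  rw [Finset.sum_comm]
  rcases eq_or_ne x x' with rfl | hx
  · simp only [if_true, ← Finset.mul_sum, hround, ← Finset.sum_mul]
    by_cases ha : a = a' <;> simp [directSum_apply, ha]
  · simp [directSum_apply, hx]

lemma trace_partialState_output (t : Fin 2) :
    (partialState (d.output σ) t).trace = ((∑ x, ∑ y, p.P x y t : ℝ) : ℂ) * σ.trace := by
  rw [← trace_traceLeft, ← trace_traceLeft, traceLeft_partialState_output]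
  simp only [trace_directSum, Matrix.trace_smul]
  rw [Finset.sum_comm]
  simp only [← Finset.smul_sum, sum_trace_eveState]
  rw [← Finset.sum_smul, Complex.real_smul]

lemma trace_output : (d.output σ).trace = σ.trace := by
  rw [← trace_traceLeft, traceLeft_eq_sum_partialState, Matrix.trace_sum]
  simp only [trace_partialState_output]
  rw [← Finset.sum_mul, ← Complex.ofReal_sum, p.sum_testBit_sum_P, Complex.ofReal_one, one_mul]

lemma stateE_eq : d.stateE σ = traceLeft (traceLeft σ) := by
  have hE : ∀ t, ∑ a, ∑ x, (∑ y, p.P x y t) • d.eveState σ x a =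
      (∑ x, ∑ y, p.P x y t) • traceLeft (traceLeft σ) := fun t => by
    rw [Finset.sum_comm, Finset.sum_smul]
    simp only [← Finset.smul_sum, sum_eveState]
  rw [stateE, traceLeft_eq_sum_partialState (d.output σ)]
  simp only [traceLeft_sum, traceLeft_partialState_output, traceLeft_directSum, hE]
  rw [← Finset.sum_smul, p.sum_testBit_sum_P, one_smul]

lemma posSemidef_stateE (hσ : σ.PosSemidef) : (d.stateE σ).PosSemidef := by
  rw [stateE_eq]
  exact posSemidef_traceLeft (posSemidef_traceLeft hσ)

lemma keyTrace_eq_sum (hσ : σ.PosSemidef) (α : ℝ) (x : 𝒳) :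
    d.keyTrace σ α x = ∑ a, petzTrace α (d.eveState σ x a) (d.stateE σ) := by
  rw [keyTrace, stateAE_eq_directSum, mpow,
    cfc_directSum fun a => (d.posSemidef_eveState hσ x a).1, one_kronecker_eq_directSum, ← map_mul,
    trace_directSum, Complex.re_sum]
  rfl

section KeyEntropy

lemma keyState_eq (hσ : σ.trace ≠ 0) :
    d.keyState σ = directSum fun a => directSum fun x => p.probXKey x • d.eveState σ x a := by
  rw [keyState, conditionalState, traceLeft_smul, traceLeft_smul, traceLeft_partialState_output,
    trace_output, trace_partialState_output, div_mul_cancel_right₀ hσ, ← Complex.ofReal_inv,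
    Complex.coe_smul, ← map_smul]
  congr 1
  ext1 a
  rw [Pi.smul_apply, ← map_smul]
  congr 1
  ext1 x
  rw [Pi.smul_apply, smul_smul, inv_mul_eq_div]
  rfl

lemma trace_keyState (hσ : σ.trace ≠ 0) (hp : p.probKey ≠ 0) : (d.keyState σ).trace = σ.trace := by
  rw [keyState_eq d hσ]
  simp only [trace_directSum, Matrix.trace_smul]
  rw [Finset.sum_comm]
  simp only [← Finset.smul_sum, sum_trace_eveState, ← Finset.sum_smul, p.sum_probXKey hp, one_smul]

lemma traceLeft_keyState (hσ : σ.trace ≠ 0) :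
    traceLeft (d.keyState σ) = directSum fun x => p.probXKey x • d.stateE σ := by
  rw [keyState_eq d hσ, traceLeft_directSum, ← map_sum, stateE_eq]
  congr 1
  ext1 x
  rw [Finset.sum_apply, ← Finset.smul_sum, sum_eveState]

lemma dominated_keyState (hσ : IsState σ) :
    Dominated (d.keyState σ) ((1 : Matrix 𝒜 𝒜 ℂ) ⊗ₖ traceLeft (d.keyState σ)) := by
  rw [keyState_eq d (by simp [hσ.2])]
  exact dominated_one_kronecker_traceLeft_directSum fun a => posSemidef_directSum fun x =>
    (d.posSemidef_eveState hσ.1 x a).smul (p.probXKey_nonneg x)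

lemma petzTrace_keyState (hσ : IsState σ) (α : ℝ) :
    petzTrace α (d.keyState σ) ((1 : Matrix 𝒜 𝒜 ℂ) ⊗ₖ traceLeft (d.keyState σ)) =
      ∑ x ∈ p.keyX, p.probXKey x * d.keyTrace σ α x := by
  have hσ₀ : σ.trace ≠ 0 := by simp [hσ.2]
  have hA := d.posSemidef_eveState hσ.1
  have hE := d.posSemidef_stateE hσ.1
  have hA_smul : ∀ a x, (p.probXKey x • d.eveState σ x a).IsHermitian := fun a x =>
    ((hA x a).smul (p.probXKey_nonneg x)).1
  have hE_smul : ∀ x, (p.probXKey x • d.stateE σ).IsHermitian := fun x =>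
    (hE.smul (p.probXKey_nonneg x)).1
  calc petzTrace α (d.keyState σ) ((1 : Matrix 𝒜 𝒜 ℂ) ⊗ₖ traceLeft (d.keyState σ))
      = ∑ a, ∑ x, petzTrace α (p.probXKey x • d.eveState σ x a) (p.probXKey x • d.stateE σ) := by
        rw [traceLeft_keyState d hσ₀, one_kronecker_eq_directSum, keyState_eq d hσ₀,
          petzTrace_directSum (fun a => isHermitian_directSum (hA_smul a))
            fun _ => isHermitian_directSum hE_smul]
        simp only [petzTrace_directSum (hA_smul _) hE_smul]
    _ = ∑ x, p.probXKey x * d.keyTrace σ α x := by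
        simp only [petzTrace_smul_smul (hA _ _) hE α (p.probXKey_nonneg _)]
        rw [Finset.sum_comm]
        simp only [← Finset.mul_sum, ← keyTrace_eq_sum d hσ.1]
    _ = ∑ x ∈ p.keyX, p.probXKey x * d.keyTrace σ α x :=
        (Finset.sum_subset (Finset.subset_univ _) fun x _ hx => by
          rw [p.probXKey_eq_zero_of_notMem hx, zero_mul]).symm

theorem keyEntropy_eq (hσ : IsState σ) (hp : p.probKey ≠ 0) (α : ℝ) :
    d.keyEntropy σ α = ((1 / (1 - α) *
      Real.logb 2 (∑ x ∈ p.keyX, p.probXKey x * d.keyTrace σ α x) : ℝ) : EReal) := by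
  rw [keyEntropy, petzCondEntropy, petzDivergence, if_pos (Or.inr (d.dominated_keyState hσ)),
    petzTrace_keyState d hσ, trace_keyState d (by simp [hσ.2]) hp, hσ.2, Complex.one_re, div_one,
    ← EReal.coe_neg, ← neg_mul, ← neg_sub α 1, one_div, one_div, inv_neg]

end KeyEntropy

lemma exists_keyTrace_le_objective {α : ℝ} (hα : α ≠ 0) (hsin : Real.sin (α * Real.pi) ≠ 0)
    {m : ℕ} {t w : Fin m → ℝ} (ht : ∀ i, 0 < t i ∧ t i ≤ 1)
    (h : ∀ x : ℝ, 0 < x → x ^ (α - 1) ≤ 1 + ∑ i, w i * ((x - 1) / (t i + (1 - t i) * x)))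
    (hσ : σ.PosSemidef) (x : 𝒳) :
    ∃ Z : 𝒜 → Fin m → Matrix e e ℂ, d.keyTrace σ α x ≤
      d.objective σ α t (fun i => w i / -(Real.sin (α * Real.pi) / Real.pi)) x Z := by
  have hE : d.stateE σ = traceLeft (traceLeft σ) := d.stateE_eq
  have hdom : ∀ a, Dominated (d.eveState σ x a) (d.stateE σ) := fun a =>
    dominated_of_posSemidef_sub (d.posSemidef_eveState hσ x a)
      (hE ▸ d.posSemidef_traceLeft_sub_eveState hσ x a)
  choose Z hZ using fun a => exists_petzTrace_le hα ht h (d.posSemidef_eveState hσ x a)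
    (d.posSemidef_stateE hσ) (hdom a)
  have : Real.sin (α * Real.pi) / Real.pi ≠ 0 := div_ne_zero hsin Real.pi_ne_zero
  refine ⟨Z, ?_⟩
  calc d.keyTrace σ α x = ∑ a, petzTrace α (d.eveState σ x a) (d.stateE σ) :=
        d.keyTrace_eq_sum hσ α x
    _ = ∑ a ∈ p.outA x, petzTrace α (d.eveState σ x a) (d.stateE σ) :=
        (Finset.sum_subset (Finset.subset_univ _) fun a _ ha => by
          rw [eveState_of_notMem d ha, petzTrace_zero_left hα]).symm
    _ ≤ ∑ a ∈ p.outA x, ((d.eveState σ x a).trace.re -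
          ∑ i, w i / t i * quadCost (t i) (d.eveState σ x a) (d.stateE σ) (Z a i)) :=
        Finset.sum_le_sum fun a _ => hZ a
    _ = _ := by
        rw [objective_eq_sum d α fun i => (ht i).1.ne', ← hE]
        simp only [sub_eq_add_neg, Finset.mul_sum, ← Finset.sum_neg_distrib]
        refine Finset.sum_congr rfl fun a _ => congrArg _ (Finset.sum_congr rfl fun i _ => ?_)
        field_simp

end Output

end Devices

lemma sin_mul_pi_neg {α : ℝ} (hα₁ : 1 < α) (hα₂ : α < 2) : Real.sin (α * Real.pi) < 0 := by
  rw [← Real.sin_sub_two_pi, ← sub_mul]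
  exact Real.sin_neg_of_neg_of_neg_pi_lt (mul_neg_of_neg_of_pos (by linarith) Real.pi_pos)
    (by nlinarith [Real.pi_pos])

end DIRenyi

theorem proposition6_general (α : ℝ) :
    (0 < α → α ≠ 1 → ∀ (𝒳 𝒴 𝒜 ℬ 𝒞 qA qB e : Type*)
      [Fintype 𝒳] [Fintype 𝒴] [Fintype 𝒜] [Fintype ℬ] [Fintype 𝒞]
      [DecidableEq 𝒳] [DecidableEq 𝒴] [DecidableEq 𝒜] [DecidableEq 𝒞]
      [Fintype qA] [Fintype qB] [Fintype e] [DecidableEq qA] [DecidableEq qB] [DecidableEq e]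
      (p : Protocol 𝒳 𝒴 𝒜 ℬ 𝒞) (d : Devices p qA qB)
      (σ : Matrix (qA × qB × e) (qA × qB × e) ℂ), IsState σ → 0 < p.probKey →
        d.keyEntropy σ α =
          ((1 / (1 - α) *
            Real.logb 2 (∑ x ∈ p.keyX, p.probXKey x * d.keyTrace σ α x) : ℝ) : EReal)) ∧
    (1 < α → α < 2 → ∀ m : ℕ, 1 ≤ m → ∃ t w : Fin m → ℝ,
      (∀ i, 0 < t i ∧ t i ≤ 1) ∧ (∀ i, 0 < w i) ∧
      ∀ (𝒳 𝒴 𝒜 ℬ 𝒞 qA qB e : Type*)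
        [Fintype 𝒳] [Fintype 𝒴] [Fintype 𝒜] [Fintype ℬ] [Fintype 𝒞]
        [DecidableEq 𝒳] [DecidableEq 𝒴] [DecidableEq 𝒜] [DecidableEq 𝒞]
        [Fintype qA] [Fintype qB] [Fintype e] [DecidableEq qA] [DecidableEq qB] [DecidableEq e]
        (p : Protocol 𝒳 𝒴 𝒜 ℬ 𝒞) (d : Devices p qA qB)
        (σ : Matrix (qA × qB × e) (qA × qB × e) ℂ), σ.PosSemidef → ∀ x,
          BddAbove (Set.range fun Z : 𝒜 → Fin m → Matrix e e ℂ => d.objective σ α t w x Z) ∧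
          d.keyTrace σ α x ≤ ⨆ Z : 𝒜 → Fin m → Matrix e e ℂ, d.objective σ α t w x Z) := by
  refine ⟨fun _ _ => ?_, fun hα₁ hα₂ m hm => ?_⟩
  · intro _ _ _ _ _ _ _ _ _ _ _ _ _ _ _ _ _ _ _ _ _ _ _ p d σ hσ hp
    exact d.keyEntropy_eq hσ hp.ne' α
  · obtain ⟨t, w, ht, hw, h⟩ :=
      exists_rpow_le_gaussRadau (r := α - 1) ⟨by linarith, by linarith⟩ hm
    have hsin := sin_mul_pi_neg hα₁ hα₂
    have hw' : ∀ i, 0 < w i / -(Real.sin (α * Real.pi) / Real.pi) := fun i =>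
      div_pos (hw i) (neg_pos.2 (div_neg_of_neg_of_pos hsin Real.pi_pos))
    refine ⟨t, _, ht, hw', ?_⟩
    intro _ _ _ _ _ _ _ _ _ _ _ _ _ _ _ _ _ _ _ _ _ _ _ p d σ hσ x
    have hbdd := d.bddAbove_range_objective hsin.le ht (fun i => (hw' i).le) hσ x
    obtain ⟨Z, hZ⟩ := d.exists_keyTrace_le_objective (by linarith) hsin.ne ht h hσ x
    exact ⟨hbdd, hZ.trans (le_ciSup hbdd Z)⟩

theorem proposition6 (α : ℝ) (hα₁ : 1 < α) (hα₂ : α < 2) :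
    (∀ (𝒳 𝒴 𝒜 ℬ 𝒞 qA qB e : Type*)
      [Fintype 𝒳] [Fintype 𝒴] [Fintype 𝒜] [Fintype ℬ] [Fintype 𝒞]
      [DecidableEq 𝒳] [DecidableEq 𝒴] [DecidableEq 𝒜] [DecidableEq 𝒞]
      [Fintype qA] [Fintype qB] [Fintype e] [DecidableEq qA] [DecidableEq qB] [DecidableEq e]
      (p : Protocol 𝒳 𝒴 𝒜 ℬ 𝒞) (d : Devices p qA qB)
      (σ : Matrix (qA × qB × e) (qA × qB × e) ℂ), IsState σ → 0 < p.probKey →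
        d.keyEntropy σ α =
          ((1 / (1 - α) *
            Real.logb 2 (∑ x ∈ p.keyX, p.probXKey x * d.keyTrace σ α x) : ℝ) : EReal)) ∧
    (∀ m : ℕ, 1 ≤ m → ∃ t w : Fin m → ℝ,
      (∀ i, 0 < t i ∧ t i ≤ 1) ∧ (∀ i, 0 < w i) ∧
      ∀ (𝒳 𝒴 𝒜 ℬ 𝒞 qA qB e : Type*)
        [Fintype 𝒳] [Fintype 𝒴] [Fintype 𝒜] [Fintype ℬ] [Fintype 𝒞]
        [DecidableEq 𝒳] [DecidableEq 𝒴] [DecidableEq 𝒜] [DecidableEq 𝒞]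
        [Fintype qA] [Fintype qB] [Fintype e] [DecidableEq qA] [DecidableEq qB] [DecidableEq e]
        (p : Protocol 𝒳 𝒴 𝒜 ℬ 𝒞) (d : Devices p qA qB)
        (σ : Matrix (qA × qB × e) (qA × qB × e) ℂ), IsState σ → ∀ x ∈ p.keyX,
          BddAbove (Set.range fun Z : 𝒜 → Fin m → Matrix e e ℂ => d.objective σ α t w x Z) ∧
          d.keyTrace σ α x ≤ ⨆ Z : 𝒜 → Fin m → Matrix e e ℂ, d.objective σ α t w x Z) := by
  obtain ⟨hentropy, hbound⟩ := proposition6_general α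
  refine ⟨hentropy (by linarith) hα₁.ne', fun m hm => ?_⟩
  obtain ⟨t, w, ht, hw, h⟩ := hbound hα₁ hα₂ m hm
  exact ⟨t, w, ht, hw, fun _ _ _ _ _ _ _ _ _ _ _ _ _ _ _ _ _ _ _ _ _ _ _ p d σ hσ x _ =>
    h _ _ _ _ _ _ _ _ p d σ hσ.1 x⟩
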